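/- Let $\Gamma=(V,E)$ be a beam frame with finitely many beams: the vertices $\mathfrak v\in V$ are placed at points of $\mathbb R^3$, and each edge $e\in E$ is a straight beam of length $\ell_e>0$ with an origin and a terminus in $V$, a right-handed orthonormal basis $\{\vec i_e,\vec j_e,\vec k_e\}$ of $\mathbb R^3$ ($\vec i_e=\vec j_e\times\vec k_e$) such that $\vec i_e$ points from the origin to the terminus, and constants $a_e,b_e,c_e,d_e>0$. The edge $e$ is parameterized by arc length $x\in(0,\ell_e)$ from origin to terminus, and derivatives are with respect to $x$. Write $e\sim\mathfrak v$ if $\mathfrak v$ is the origin or the terminus of $e$, and let $s^e_{\mathfrak v}$ be $1$ if $\mathfrak v$ is the origin of $e$, $-1$ if it is the terminus, and $0$ otherwise. The value at a vertex of a function on an incident edge is its limit at the corresponding endpoint. Let $L^2(\Gamma)$ be the complex Hilbert space of all $\Psi=(v_e,w_e,u_e,\eta_e)_{e\in E}$ with $v_e,w_e,u_e,\eta_e\in L^2(0,\ell_e)$. Consider the energy form $$h[\widetilde\Psi,\Psi]=\sum_{e\in E}\int_0^{\ell_e}\Big(a_e\overline{\widetilde v_e''}v_e''+b_e\overline{\widetilde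 w_e''}w_e''+c_e\overline{\widetilde u_e'}u_e'+d_e\overline{\widetilde\eta_e'}\eta_e'\Big)\,dx$$ whose domain $\mathrm{Dom}(h)$ consists of the $\Psi$ with $v_e,w_e\in H^2(0,\ell_e)$ and $u_e,\eta_e\in H^1(0,\ell_e)$ for all $e\in E$ that satisfy conditions 1 and 2 below at every vertex (free rigid joints). Then $h$ is a densely defined, nonnegative, symmetric, closed form, and the operator $H$ associated with it (that is, $\Psi\in\mathrm{Dom}(H)$ and $H\Psi=\Phi$ if and only if $\Psi\in\mathrm{Dom}(h)$ and $h[\widetilde\Psi,\Psi]=\langle\widetilde\Psi,\Phi\rangle$ for all $\widetilde\Psi\in\mathrm{Dom}(h)$) is the following densely defined self-adjoint operator in $L^2(\Gamma)$. On every edge it acts as $$(v_e,\,w_e,\,u_e,\,\eta_e)\mapsto(a_e v_e'''',\ b_e w_e'''',\ -c_e u_e'',\ -d_e\eta_e''),$$ and its domain consists exactly of the $\Psi$ with $v_e,w_e\in H^4(0,\ell_e)$ and $u_e,\eta_e\in H^2(0,\ell_e)$ for all $e\in E$ that satisfy, at every vertex $\mathfrak v\in V$ (all functions being evaluated at $\mathfrak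 v$), 1. continuity of displacement: $u_e\vec i_e+w_e\vec j_e+v_e\vec k_e=u_{e'}\vec i_{e'}+w_{e'}\vec j_{e'}+v_{e'}\vec k_{e'}$ for all $e,e'\sim\mathfrak v$; 2. continuity of rotation: $\eta_e\vec i_e-v_e'\vec j_e+w_e'\vec k_e=\eta_{e'}\vec i_{e'}-v_{e'}'\vec j_{e'}+w_{e'}'\vec k_{e'}$ for all $e,e'\sim\mathfrak v$; 3. balance of forces: $\sum_{e\sim\mathfrak v}s^e_{\mathfrak v}\big(c_eu_e'\vec i_e-b_ew_e'''\vec j_e-a_ev_e'''\vec k_e\big)=\vec 0$; 4. balance of moments: $\sum_{e\sim\mathfrak v}s^e_{\mathfrak v}\big(d_e\eta_e'\vec i_e-a_ev_e''\vec j_e+b_ew_e''\vec k_e\big)=\vec 0$. -/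

import Mathlib

open MeasureTheory Filter Topology
open scoped ContDiff

namespace BeamTheory

noncomputable section

/-! ### Sobolev functions on an interval -/

/-- The complex Hilbert space `L²(0, ℓ)`. -/
abbrev L2I (ℓ : ℝ) : Type := Lp ℂ 2 (volume.restrict (Set.Ioo (0 : ℝ) ℓ))

/-- `g` is the weak (distributional) derivative of order `n` of `f` on the open interval `(0, ℓ)`:
`∫ φ⁽ⁿ⁾ f = (-1)ⁿ ∫ φ g` for every test function `φ ∈ C_c^∞(0, ℓ)`. -/
def IsWeakDeriv (ℓ : ℝ) (n : ℕ) (f g : L2I ℓ) : Prop :=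
  ∀ φ : ℝ → ℝ, ContDiff ℝ ∞ φ → HasCompactSupport φ → tsupport φ ⊆ Set.Ioo (0 : ℝ) ℓ →
    ∫ x in Set.Ioo (0 : ℝ) ℓ, ((iteratedDeriv n φ x : ℝ) : ℂ) * f x =
      (-1 : ℂ) ^ n * ∫ x in Set.Ioo (0 : ℝ) ℓ, ((φ x : ℝ) : ℂ) * g x

/-- Membership in the Sobolev space `Hⁿ(0, ℓ)`: all weak derivatives of order at most `n` exist
in `L²(0, ℓ)`. -/
def MemH {ℓ : ℝ} (n : ℕ) (f : L2I ℓ) : Prop :=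
  ∀ m ≤ n, ∃ g : L2I ℓ, IsWeakDeriv ℓ m f g

open Classical in
/-- The weak derivative of order `n` of `f` in `L²(0, ℓ)` (it is unique when it exists; the value
is `0` when it does not exist). -/
def weakDeriv {ℓ : ℝ} (n : ℕ) (f : L2I ℓ) : L2I ℓ :=
  if h : ∃ g : L2I ℓ, IsWeakDeriv ℓ n f g then h.choose else 0

open Classical in
/-- The representative of `f` that is continuous on the closed interval `[0, ℓ]` (its values on
`[0, ℓ]` are unique when it exists; it is `0` when there is none). -/
def contRep {ℓ : ℝ} (f : L2I ℓ) : ℝ → ℂ :=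
  if h : ∃ F : ℝ → ℂ, ContinuousOn F (Set.Icc 0 ℓ) ∧
      f =ᵐ[volume.restrict (Set.Ioo (0 : ℝ) ℓ)] F then h.choose else 0

/-- The value at the endpoint `x ∈ {0, ℓ}` of the derivative of order `n` of `f`.  It is used only
for `f ∈ H^m(0, ℓ)` with `n < m`, where the derivative of order `n` is continuous up to the
endpoints. -/
def endValue {ℓ : ℝ} (n : ℕ) (f : L2I ℓ) (x : ℝ) : ℂ := contRep (weakDeriv n f) x

/-! ### Sesquilinear forms in a Hilbert space and the operators they define -/

section Forms

variable {𝓗 : Type*} [NormedAddCommGroup 𝓗] [InnerProductSpace ℂ 𝓗]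

/-- `h`, with domain `D`, is a densely defined, nonnegative, symmetric, closed sesquilinear form in
`𝓗` (antilinear in the first argument; this follows from `add_right`, `smul_right` and `symm`).
The values of `h` off `D` are irrelevant. -/
structure IsClosedNonnegForm (D : Set 𝓗) (h : 𝓗 → 𝓗 → ℂ) : Prop where
  zero_mem : (0 : 𝓗) ∈ D
  add_mem : ∀ x ∈ D, ∀ y ∈ D, x + y ∈ D
  smul_mem : ∀ (r : ℂ), ∀ x ∈ D, r • x ∈ D
  dense : Dense D
  add_right : ∀ x ∈ D, ∀ y ∈ D, ∀ z ∈ D, h x (y + z) = h x y + h x z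
  smul_right : ∀ x ∈ D, ∀ y ∈ D, ∀ r : ℂ, h x (r • y) = r * h x y
  symm : ∀ x ∈ D, ∀ y ∈ D, h x y = (starRingEnd ℂ) (h y x)
  nonneg : ∀ x ∈ D, 0 ≤ (h x x).re
  /-- If `xₙ ∈ D`, `xₙ → y` in `𝓗` and `h[xₙ - xₘ, xₙ - xₘ] → 0`, then `y ∈ D` and
  `h[xₙ - y, xₙ - y] → 0`. -/
  closed : ∀ (x : ℕ → 𝓗) (y : 𝓗), (∀ n, x n ∈ D) → Tendsto x atTop (𝓝 y) →
    (∀ ε : ℝ, 0 < ε → ∃ N : ℕ, ∀ m ≥ N, ∀ n ≥ N, ‖h (x m - x n) (x m - x n)‖ < ε) →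
    y ∈ D ∧ Tendsto (fun n => h (x n - y) (x n - y)) atTop (𝓝 0)

/-- `A` is the operator associated with the form `h` with domain `D`: one has `x ∈ Dom A` and
`A x = y` if and only if `x ∈ D` and `h[z, x] = ⟨z, y⟩` for all `z ∈ D`. -/
def IsAssociatedOperator (D : Set 𝓗) (h : 𝓗 → 𝓗 → ℂ) (A : 𝓗 →ₗ.[ℂ] 𝓗) : Prop :=
  ∀ x y : 𝓗, (x, y) ∈ A.graph ↔ x ∈ D ∧ ∀ z ∈ D, h z x = inner ℂ z y

end Forms

/-! ### Beam frames -/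

/-- The four degrees of freedom of a beam: lateral displacements `v` (along `k`) and `w`
(along `j`), axial displacement `u` (along `i`), in-axis angular displacement `η`. -/
inductive DOF : Type
  | v | w | u | η
  deriving DecidableEq

instance : Fintype DOF := ⟨{DOF.v, DOF.w, DOF.u, DOF.η}, by rintro (_ | _ | _ | _) <;> simp⟩

/-- A beam frame: a graph whose vertices are placed in `ℝ³` and whose edges are straight
beams, each with an origin, a terminus, a length, a right-handed orthonormal local basis `(i, j, k)`
with `i` pointing from the origin to the terminus, and positive stiffness constants. -/
structure BeamFrame (V E : Type*) where
  pos : V → EuclideanSpace ℝ (Fin 3)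
  org : E → V
  ter : E → V
  length : E → ℝ
  i : E → EuclideanSpace ℝ (Fin 3)
  j : E → EuclideanSpace ℝ (Fin 3)
  k : E → EuclideanSpace ℝ (Fin 3)
  a : E → ℝ
  b : E → ℝ
  c : E → ℝ
  d : E → ℝ
  length_pos : ∀ e, 0 < length e
  axis : ∀ e, pos (ter e) - pos (org e) = length e • i e
  orthonormal : ∀ e, Orthonormal ℝ ![i e, j e, k e]
  rightHanded : ∀ e, (i e).ofLp = crossProduct (j e).ofLp (k e).ofLp
  a_pos : ∀ e, 0 < a e
  b_pos : ∀ e, 0 < b e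
  c_pos : ∀ e, 0 < c e
  d_pos : ∀ e, 0 < d e

/-- A real vector of `ℝ³` regarded as a vector of `ℂ³`. -/
def toC3 (x : EuclideanSpace ℝ (Fin 3)) : Fin 3 → ℂ := fun m => (x m : ℂ)

namespace BeamFrame

variable {V E : Type*} (F : BeamFrame V E)

/-- `e ∼ 𝔳`: the vertex is the origin or the terminus of the edge. -/
def Incident (e : E) (𝔳 : V) : Prop := F.org e = 𝔳 ∨ F.ter e = 𝔳

open Classical in
/-- The signed incidence indicator: `1` at the origin, `-1` at the terminus, `0` otherwise.  (An
edge is never a loop, because its length is positive.) -/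
def sign (e : E) (𝔳 : V) : ℂ := if F.org e = 𝔳 then 1 else if F.ter e = 𝔳 then -1 else 0

open Classical in
/-- The arc-length coordinate on `[0, ℓ]` of a vertex incident to the edge `e`: `0` at the origin
and `ℓ` at the terminus. -/
def coord (e : E) (𝔳 : V) : ℝ := if F.org e = 𝔳 then 0 else F.length e

variable [Fintype E]

/-- The Hilbert space `L²(Γ)`, the orthogonal sum over all edges `e` of four copies of
`L²(0, ℓₑ)`, one for each of the fields `v, w, u, η`. -/
abbrev L2 : Type _ := PiLp 2 (fun p : E × DOF => L2I (F.length p.1))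

variable {F}

/-- The value at the vertex `𝔳` of the `n`-th derivative (in the direction `iₑ`) of the field
`q ∈ {v, w, u, η}` on the edge `e` incident to `𝔳`. -/
def vert (Ψ : F.L2) (q : DOF) (n : ℕ) (e : E) (𝔳 : V) : ℂ :=
  endValue n (Ψ (e, q)) (F.coord e 𝔳)

/-- The displacement vector `u i + w j + v k` of the edge `e` at the vertex `𝔳`. -/
def displacement (Ψ : F.L2) (e : E) (𝔳 : V) : Fin 3 → ℂ :=
  vert Ψ .u 0 e 𝔳 • toC3 (F.i e) + vert Ψ .w 0 e 𝔳 • toC3 (F.j e) + vert Ψ .v 0 e 𝔳 • toC3 (F.k e)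

/-- The linearized rotation vector `η i - v' j + w' k` of the edge `e` at the vertex `𝔳`. -/
def rotation (Ψ : F.L2) (e : E) (𝔳 : V) : Fin 3 → ℂ :=
  vert Ψ .η 0 e 𝔳 • toC3 (F.i e) - vert Ψ .v 1 e 𝔳 • toC3 (F.j e) + vert Ψ .w 1 e 𝔳 • toC3 (F.k e)

/-- The force vector `c u' i - b w''' j - a v''' k` of the edge `e` at the vertex `𝔳`. -/
def force (Ψ : F.L2) (e : E) (𝔳 : V) : Fin 3 → ℂ :=
  ((F.c e : ℂ) * vert Ψ .u 1 e 𝔳) • toC3 (F.i e) - ((F.b e : ℂ) * vert Ψ .w 3 e 𝔳) • toC3 (F.j e)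
    - ((F.a e : ℂ) * vert Ψ .v 3 e 𝔳) • toC3 (F.k e)

/-- The moment vector `d η' i - a v'' j + b w'' k` of the edge `e` at the vertex `𝔳`. -/
def moment (Ψ : F.L2) (e : E) (𝔳 : V) : Fin 3 → ℂ :=
  ((F.d e : ℂ) * vert Ψ .η 1 e 𝔳) • toC3 (F.i e) - ((F.a e : ℂ) * vert Ψ .v 2 e 𝔳) • toC3 (F.j e)
    + ((F.b e : ℂ) * vert Ψ .w 2 e 𝔳) • toC3 (F.k e)

/-- Continuity of displacement at the vertex `𝔳`. -/
def DisplacementContinuous (Ψ : F.L2) (𝔳 : V) : Prop :=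
  ∀ e e' : E, F.Incident e 𝔳 → F.Incident e' 𝔳 → displacement Ψ e 𝔳 = displacement Ψ e' 𝔳

/-- Continuity of rotation at the vertex `𝔳`. -/
def RotationContinuous (Ψ : F.L2) (𝔳 : V) : Prop :=
  ∀ e e' : E, F.Incident e 𝔳 → F.Incident e' 𝔳 → rotation Ψ e 𝔳 = rotation Ψ e' 𝔳

open Classical in
/-- Balance of forces at the vertex `𝔳`. -/
def ForceBalance (Ψ : F.L2) (𝔳 : V) : Prop :=
  ∑ e : E with F.Incident e 𝔳, F.sign e 𝔳 • force Ψ e 𝔳 = 0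

open Classical in
/-- Balance of moments at the vertex `𝔳`. -/
def MomentBalance (Ψ : F.L2) (𝔳 : V) : Prop :=
  ∑ e : E with F.Incident e 𝔳, F.sign e 𝔳 • moment Ψ e 𝔳 = 0

variable (F)

/-- The domain of the energy form: fields in `⊕H² ⊕ ⊕H² ⊕ ⊕H¹ ⊕ ⊕H¹` with continuous displacement
and rotation at every vertex (free rigid joints). -/
def formDomain : Set F.L2 :=
  {Ψ | (∀ e, MemH 2 (Ψ (e, .v)) ∧ MemH 2 (Ψ (e, .w)) ∧ MemH 1 (Ψ (e, .u)) ∧ MemH 1 (Ψ (e, .η))) ∧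
    ∀ 𝔳, DisplacementContinuous Ψ 𝔳 ∧ RotationContinuous Ψ 𝔳}

/-- The sesquilinear energy form
`h[Φ, Ψ] = ∑ₑ ∫ₑ (a conj(v_Φ'') v_Ψ'' + b conj(w_Φ'') w_Ψ'' + c conj(u_Φ') u_Ψ' + d conj(η_Φ') η_Ψ')`,
where each integral is written as an inner product of `L²(0, ℓₑ)`, antilinear in the first
argument. -/
def energyForm (Φ Ψ : F.L2) : ℂ :=
  ∑ e : E,
    ((F.a e : ℂ) * inner ℂ (weakDeriv 2 (Φ (e, .v))) (weakDeriv 2 (Ψ (e, .v))) +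
      (F.b e : ℂ) * inner ℂ (weakDeriv 2 (Φ (e, .w))) (weakDeriv 2 (Ψ (e, .w))) +
      (F.c e : ℂ) * inner ℂ (weakDeriv 1 (Φ (e, .u))) (weakDeriv 1 (Ψ (e, .u))) +
      (F.d e : ℂ) * inner ℂ (weakDeriv 1 (Φ (e, .η))) (weakDeriv 1 (Ψ (e, .η))))

/-- The domain of the Hamiltonian: fields in `⊕H⁴ ⊕ ⊕H⁴ ⊕ ⊕H² ⊕ ⊕H²` that satisfy, at every vertex,
continuity of displacement and of rotation and balance of forces and of moments. -/
def operatorDomain : Set F.L2 :=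
  {Ψ | (∀ e, MemH 4 (Ψ (e, .v)) ∧ MemH 4 (Ψ (e, .w)) ∧ MemH 2 (Ψ (e, .u)) ∧ MemH 2 (Ψ (e, .η))) ∧
    ∀ 𝔳, DisplacementContinuous Ψ 𝔳 ∧ RotationContinuous Ψ 𝔳 ∧ ForceBalance Ψ 𝔳 ∧
      MomentBalance Ψ 𝔳}

end BeamFrame

end

end BeamTheory

/-! The energy form is `⟪T Φ, T Ψ⟫` for the strain operator `T = strain F`, which sends a field to
its highest weak derivative occurring in the energy, times the square root of the stiffness.
Everything abstract then follows from `T` being densely defined and closed (`dense_formDomain`,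
`isClosed_strain`): the form is closed, and its associated operator `H = T* T` is self-adjoint,
because projecting `(y, 0)` onto the graph of `T` solves `x + H x = y` for every `y`.

What remains is to identify `H`. Testing the weak equation with fields supported inside one beam
shows that `Ψ` has weak derivatives of the full order and that `H Ψ` is the differential expression.
Hence all lower derivatives exist and are continuous up to the ends (`IsWeakDeriv.exists_prim`, the
du Bois-Reymond lemma), so Green's formula holds: `h[Φ, Ψ]` equals `⟪Φ, diffExpr Ψ⟫` minus the
boundary work, which pairs displacement with force and rotation with moment. At a rigid joint the
displacement and rotation of `Φ` are common to all beams, so the work at a vertex involves only the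
resultant force and moment. As the joint data of `Φ` can be prescribed freely (cubic Hermite
interpolation on every beam), the work vanishes for all admissible `Φ` exactly when both resultants
vanish. -/

namespace BeamTheory

noncomputable section

/-! ### Integration by parts for primitives -/

/-- Fubini on the square `(0, ℓ]²`: the two terms integrate `f x * g t` over the triangles `t ≤ x`
and `x < t`. No differentiability of the primitives is involved, so integrable `f` and `g` suffice.
-/
lemma integral_mul_primitive_add_primitive_mul {f g : ℝ → ℂ} {ℓ : ℝ} (hℓ : 0 ≤ ℓ)
    (hf : IntervalIntegrable f volume 0 ℓ) (hg : IntervalIntegrable g volume 0 ℓ) :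
    (∫ x in 0..ℓ, f x * ∫ t in 0..x, g t) + (∫ x in 0..ℓ, (∫ t in 0..x, f t) * g x) =
      (∫ x in 0..ℓ, f x) * ∫ x in 0..ℓ, g x := by
  rw [intervalIntegrable_iff_integrableOn_Ioc_of_le hℓ] at hf hg
  set μ := volume.restrict (Set.Ioc 0 ℓ) with hμ
  have hint : Integrable (Set.indicator {p : ℝ × ℝ | p.1 < p.2} (fun p => f p.1 * g p.2))
      (μ.prod μ) :=
    (Integrable.mul_prod hf hg).indicator (measurableSet_lt measurable_fst measurable_snd)
  have hswap := integral_integral_swap (f := fun x t =>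
    Set.indicator {p : ℝ × ℝ | p.1 < p.2} (fun p => f p.1 * g p.2) (x, t)) hint
  have h1 : (∫ x in 0..ℓ, (∫ t in 0..x, f t) * g x) =
      ∫ x, f x * (∫ t, Set.indicator (Set.Ioi x) g t ∂μ) ∂μ := by
    rw [intervalIntegral.integral_of_le hℓ]
    have e1 : ∀ x, (∫ t, Set.indicator {p : ℝ × ℝ | p.1 < p.2} (fun p => f p.1 * g p.2) (x, t) ∂μ)
        = f x * (∫ t, Set.indicator (Set.Ioi x) g t ∂μ) := by
      intro x
      rw [← integral_const_mul]
      congr 1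
      ext t
      by_cases h : x < t <;> simp [Set.indicator, h]
    simp_rw [← e1]
    rw [hswap]
    refine setIntegral_congr_fun measurableSet_Ioc fun x hx => ?_
    have e2 : ∀ t, Set.indicator {p : ℝ × ℝ | p.1 < p.2} (fun p => f p.1 * g p.2) (t, x) =
        Set.indicator (Set.Iio x) f t * g x := by
      intro t
      by_cases h : t < x <;> simp [Set.indicator, h]
    refine Eq.trans ?_ (integral_congr_ae (Eventually.of_forall e2)).symm
    rw [integral_mul_const, hμ, setIntegral_indicator measurableSet_Iio]
    have : Set.Ioc 0 ℓ ∩ Set.Iio x = Set.Ioo 0 x := by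
      ext t; simp only [Set.mem_inter_iff, Set.mem_Ioc, Set.mem_Iio, Set.mem_Ioo]
      exact ⟨fun h => ⟨h.1.1, h.2⟩, fun h => ⟨⟨h.1, h.2.le.trans hx.2⟩, h.2⟩⟩
    rw [this, intervalIntegral.integral_of_le hx.1.le, integral_Ioc_eq_integral_Ioo]
  have h2 : (∫ x in 0..ℓ, f x * ∫ t in 0..x, g t) =
      ∫ x, f x * (∫ t, Set.indicator (Set.Iic x) g t ∂μ) ∂μ := by
    rw [intervalIntegral.integral_of_le hℓ]
    refine setIntegral_congr_fun measurableSet_Ioc fun x hx => ?_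
    rw [hμ, setIntegral_indicator measurableSet_Iic]
    have : Set.Ioc 0 ℓ ∩ Set.Iic x = Set.Ioc 0 x := by
      ext t; simp only [Set.mem_inter_iff, Set.mem_Ioc, Set.mem_Iic]
      exact ⟨fun h => ⟨h.1.1, h.2⟩, fun h => ⟨⟨h.1, h.2.trans hx.2⟩, h.2⟩⟩
    rw [this, intervalIntegral.integral_of_le hx.1.le]
  have h3 : ∀ x, f x * (∫ t, Set.indicator (Set.Ioi x) g t ∂μ) = f x * (∫ t, g t ∂μ) -
      f x * (∫ t, Set.indicator (Set.Iic x) g t ∂μ) := by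
    intro x
    rw [← mul_sub, ← integral_sub hg (hg.indicator measurableSet_Iic)]
    congr 2
    ext t
    by_cases h : t ≤ x <;> simp [Set.indicator, h, not_lt.2, not_le.1]
  have hi : Integrable (fun x => f x * (∫ t, Set.indicator (Set.Iic x) g t ∂μ)) μ := by
    have hint' : Integrable (Set.indicator {p : ℝ × ℝ | p.2 ≤ p.1} (fun p => f p.1 * g p.2))
        (μ.prod μ) :=
      (Integrable.mul_prod hf hg).indicator (measurableSet_le measurable_snd measurable_fst)
    refine hint'.integral_prod_left.congr (Eventually.of_forall fun x => ?_)
    simp only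
    rw [← integral_const_mul]
    congr 1
    ext t
    by_cases h : t ≤ x <;> simp [Set.indicator, h]
  rw [h1, h2]
  simp_rw [h3]
  rw [integral_sub (hf.mul_const _) hi, integral_mul_const,
    intervalIntegral.integral_of_le hℓ, intervalIntegral.integral_of_le hℓ]
  ring

/-! ### Continuous functions and primitives as elements of `L²(0, ℓ)` -/

variable {ℓ : ℝ}

lemma memLp_of_continuous {p : ℝ → ℂ} (hp : Continuous p) :
    MemLp p 2 (volume.restrict (Set.Ioo (0 : ℝ) ℓ)) := by
  obtain ⟨C, hC⟩ := isCompact_Icc.exists_bound_of_continuousOn (s := Set.Icc (0 : ℝ) ℓ)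
    hp.continuousOn
  refine MemLp.of_bound hp.aestronglyMeasurable C ?_
  filter_upwards [ae_restrict_mem measurableSet_Ioo] with x hx
  exact hC x (Set.Ioo_subset_Icc_self hx)

/-- The class in `L²(0, ℓ)` of a continuous function. -/
def ofCont (p : ℝ → ℂ) (hp : Continuous p) : L2I ℓ := (memLp_of_continuous hp).toLp p

lemma coeFn_ofCont (p : ℝ → ℂ) (hp : Continuous p) :
    (ofCont p hp : L2I ℓ) =ᵐ[volume.restrict (Set.Ioo (0 : ℝ) ℓ)] p :=
  MemLp.coeFn_toLp _

lemma integrableOn_coeFn (g : L2I ℓ) : IntegrableOn g (Set.Ioo 0 ℓ) :=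
  (Lp.memLp g).integrable one_le_two

lemma integrable_indicator_coeFn (g : L2I ℓ) : Integrable ((Set.Ioo 0 ℓ).indicator g) :=
  (integrable_indicator_iff measurableSet_Ioo).2 (integrableOn_coeFn g)

/-- The primitive of `g` on `[0, ℓ]` with the value `c` at `0`. -/
def primFun (c : ℂ) (g : L2I ℓ) (x : ℝ) : ℂ := c + ∫ t in 0..x, (Set.Ioo 0 ℓ).indicator g t

/-- Truncation by the indicator makes the integrand integrable on the whole line, so the primitive
is continuous everywhere and `ofCont` applies to it. -/
lemma continuous_primFun (c : ℂ) (g : L2I ℓ) : Continuous (primFun c g) :=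
  continuous_const.add (intervalIntegral.continuous_primitive
    (fun _ _ => (integrable_indicator_coeFn g).intervalIntegrable) 0)

@[simp] lemma primFun_zero (c : ℂ) (g : L2I ℓ) : primFun c g 0 = c := by simp [primFun]

/-- The class of `primFun c g` in `L²(0, ℓ)`. -/
def prim (c : ℂ) (g : L2I ℓ) : L2I ℓ := ofCont (primFun c g) (continuous_primFun c g)

lemma coeFn_prim (c : ℂ) (g : L2I ℓ) :
    (prim c g : L2I ℓ) =ᵐ[volume.restrict (Set.Ioo (0 : ℝ) ℓ)] primFun c g :=
  coeFn_ofCont _ _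

lemma star_primFun (c : ℂ) (g : L2I ℓ) (x : ℝ) :
    (starRingEnd ℂ) (primFun c g x) = primFun ((starRingEnd ℂ) c) (star g) x := by
  simp only [primFun, map_add]
  congr 1
  rw [← intervalIntegral.intervalIntegral_conj]
  refine intervalIntegral.integral_congr_ae ?_
  have := (ae_restrict_iff' measurableSet_Ioo).1 (Lp.coeFn_star g)
  filter_upwards [this] with t ht _
  by_cases h : t ∈ Set.Ioo 0 ℓ
  · simp [h, ht h]
  · simp [h]

lemma setIntegral_eq_intervalIntegral_indicator (hℓ : 0 ≤ ℓ) (g : ℝ → ℂ) :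
    ∫ x in Set.Ioo 0 ℓ, g x = ∫ x in 0..ℓ, (Set.Ioo 0 ℓ).indicator g x := by
  rw [intervalIntegral.integral_of_le hℓ, integral_Ioc_eq_integral_Ioo]
  exact (setIntegral_congr_fun measurableSet_Ioo fun x hx => by simp [hx])

lemma integral_mul_primFun (hℓ : 0 ≤ ℓ) (c d : ℂ) (f g : L2I ℓ) :
    (∫ x in Set.Ioo 0 ℓ, f x * primFun d g x) + (∫ x in Set.Ioo 0 ℓ, primFun c f x * g x) =
      primFun c f ℓ * primFun d g ℓ - c * d := by
  have hf := (integrable_indicator_coeFn f).intervalIntegrable (a := 0) (b := ℓ)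
  have hg := (integrable_indicator_coeFn g).intervalIntegrable (a := 0) (b := ℓ)
  have key := integral_mul_primitive_add_primitive_mul hℓ hf hg
  rw [setIntegral_eq_intervalIntegral_indicator hℓ, setIntegral_eq_intervalIntegral_indicator hℓ]
  have e1 : ∀ x, (Set.Ioo 0 ℓ).indicator (fun x => f x * primFun d g x) x =
      (Set.Ioo 0 ℓ).indicator f x * d + (Set.Ioo 0 ℓ).indicator f x *
        ∫ t in 0..x, (Set.Ioo 0 ℓ).indicator g t := by
    intro x
    by_cases h : x ∈ Set.Ioo 0 ℓ <;> simp [h, primFun, mul_add]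
  have e2 : ∀ x, (Set.Ioo 0 ℓ).indicator (fun x => primFun c f x * g x) x =
      c * (Set.Ioo 0 ℓ).indicator g x + (∫ t in 0..x, (Set.Ioo 0 ℓ).indicator f t) *
        (Set.Ioo 0 ℓ).indicator g x := by
    intro x
    by_cases h : x ∈ Set.Ioo 0 ℓ <;> simp [h, primFun, add_mul]
  simp_rw [e1, e2]
  have c1 : Continuous fun x : ℝ => ∫ t in 0..x, (Set.Ioo 0 ℓ).indicator g t :=
    intervalIntegral.continuous_primitive
      (fun _ _ => (integrable_indicator_coeFn g).intervalIntegrable) 0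
  have c2 : Continuous fun x : ℝ => ∫ t in 0..x, (Set.Ioo 0 ℓ).indicator f t :=
    intervalIntegral.continuous_primitive
      (fun _ _ => (integrable_indicator_coeFn f).intervalIntegrable) 0
  rw [intervalIntegral.integral_add (hf.mul_const _) (hf.mul_continuousOn c1.continuousOn),
    intervalIntegral.integral_add (hg.const_mul _) (hg.continuousOn_mul c2.continuousOn),
    intervalIntegral.integral_mul_const, intervalIntegral.integral_const_mul]
  simp only [primFun]
  linear_combination key

lemma inner_L2I (f g : L2I ℓ) :
    inner ℂ f g = ∫ x in Set.Ioo 0 ℓ, (starRingEnd ℂ) (f x) * g x := by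
  rw [L2.inner_def]
  simp [mul_comm]

/-- Integration by parts for absolutely continuous functions. -/
lemma inner_prim_add_inner_prim (hℓ : 0 ≤ ℓ) (c d : ℂ) (f g : L2I ℓ) :
    inner ℂ f (prim d g) + inner ℂ (prim c f) g =
      (starRingEnd ℂ) (primFun c f ℓ) * primFun d g ℓ - (starRingEnd ℂ) c * d := by
  rw [star_primFun, ← integral_mul_primFun hℓ, inner_L2I, inner_L2I]
  congr 1
  · refine integral_congr_ae ?_
    filter_upwards [coeFn_prim d g, Lp.coeFn_star f] with x h1 h2
    rw [h1, h2]; rfl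
  · refine integral_congr_ae ?_
    filter_upwards [coeFn_prim c f] with x h1
    rw [h1, star_primFun]

/-- Classical derivatives enter the theory of primitives here, through the fundamental theorem of
calculus. The pointwise identity is confined to `[0, ℓ]` because `primFun` is constant beyond the
endpoints. -/
lemma ofCont_eq_prim {p p' : ℝ → ℂ} (hp' : Continuous p')
    (h : ∀ x, HasDerivAt p (p' x) x) :
    (ofCont p (continuous_iff_continuousAt.2 fun x => (h x).continuousAt) : L2I ℓ) =
      prim (p 0) (ofCont p' hp') ∧
    ∀ x ∈ Set.Icc 0 ℓ, primFun (p 0) (ofCont p' hp' : L2I ℓ) x = p x := by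
  have key : ∀ x ∈ Set.Icc 0 ℓ, primFun (p 0) (ofCont p' hp' : L2I ℓ) x = p x := by
    intro x hx
    have : ∫ t in 0..x, (Set.Ioo 0 ℓ).indicator (ofCont p' hp' : L2I ℓ) t =
        ∫ t in 0..x, p' t := by
      rw [intervalIntegral.integral_of_le hx.1, intervalIntegral.integral_of_le hx.1,
        integral_Ioc_eq_integral_Ioo, integral_Ioc_eq_integral_Ioo]
      refine setIntegral_congr_ae measurableSet_Ioo ?_
      have := (ae_restrict_iff' measurableSet_Ioo).1 (coeFn_ofCont (ℓ := ℓ) p' hp')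
      filter_upwards [this] with t ht h2
      have h3 : t ∈ Set.Ioo 0 ℓ := ⟨h2.1, h2.2.trans_le hx.2⟩
      simp [h3, ht h3]
    rw [primFun, this, intervalIntegral.integral_eq_sub_of_hasDerivAt (fun t _ => h t)
      (hp'.intervalIntegrable _ _)]
    ring
  refine ⟨?_, key⟩
  refine Lp.ext ?_
  filter_upwards [coeFn_ofCont (ℓ := ℓ) p (continuous_iff_continuousAt.2
    fun x => (h x).continuousAt), coeFn_prim (p 0) (ofCont p' hp' : L2I ℓ),
    ae_restrict_mem measurableSet_Ioo] with x h1 h2 h3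
  rw [h1, h2, key x (Set.Ioo_subset_Icc_self h3)]

/-! ### Test functions -/

/-- `φ ∈ C_c^∞(0, ℓ)`. -/
structure IsTest (ℓ : ℝ) (φ : ℝ → ℝ) : Prop where
  contDiff : ContDiff ℝ ∞ φ
  hasCompactSupport : HasCompactSupport φ
  tsupport_subset : tsupport φ ⊆ Set.Ioo (0 : ℝ) ℓ

namespace IsTest

variable {φ ψ : ℝ → ℝ}

lemma deriv (h : IsTest ℓ φ) : IsTest ℓ (deriv φ) :=
  ⟨(contDiff_infty_iff_deriv.1 h.contDiff).2, h.hasCompactSupport.deriv,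
    (closure_minimal support_deriv_subset (isClosed_tsupport φ)).trans h.tsupport_subset⟩

lemma iteratedDeriv (h : IsTest ℓ φ) (n : ℕ) : IsTest ℓ (iteratedDeriv n φ) := by
  induction n with
  | zero => simpa using h
  | succ n ih => rw [iteratedDeriv_succ]; exact ih.deriv

lemma eq_zero (h : IsTest ℓ φ) {x : ℝ} (hx : x ∉ Set.Ioo 0 ℓ) : φ x = 0 :=
  image_eq_zero_of_notMem_tsupport fun h' => hx (h.tsupport_subset h')

lemma hasDerivAt (h : IsTest ℓ φ) (x : ℝ) : HasDerivAt φ (_root_.deriv φ x) x :=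
  ((contDiff_infty_iff_deriv.1 h.contDiff).1 x).hasDerivAt

lemma sub_const_smul (h : IsTest ℓ φ) (h' : IsTest ℓ ψ) (c : ℝ) :
    IsTest ℓ (φ - c • ψ) := by
  have hs : tsupport (φ - c • ψ) ⊆ tsupport φ ∪ tsupport ψ := by
    refine closure_minimal (fun x hx => ?_) ((isClosed_tsupport _).union (isClosed_tsupport _))
    by_contra hn
    rw [Set.mem_union, not_or] at hn
    exact hx (by simp [image_eq_zero_of_notMem_tsupport hn.1,
      image_eq_zero_of_notMem_tsupport hn.2])
  refine ⟨h.contDiff.sub (h'.contDiff.const_smul c), ?_,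
    hs.trans (Set.union_subset h.tsupport_subset h'.tsupport_subset)⟩
  exact (h.hasCompactSupport.isCompact.union h'.hasCompactSupport.isCompact).of_isClosed_subset
    (isClosed_tsupport _) hs

/-- A test function of integral zero is the derivative of a test function. -/
lemma exists_deriv_eq (h : IsTest ℓ φ) (h0 : ∫ x, φ x = 0) :
    ∃ ψ, IsTest ℓ ψ ∧ _root_.deriv ψ = φ := by
  rcases (tsupport φ).eq_empty_or_nonempty with he | hne
  · refine ⟨0, ⟨contDiff_const, HasCompactSupport.zero, by simp⟩, ?_⟩
    rw [tsupport_eq_empty_iff] at he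
    subst he
    ext x
    simp
  -- With `a` and `b` the extreme points of the support, the primitive started at `a` vanishes to
  -- the left of `a` because `φ` does, and to the right of `b` because the total integral is zero.
  -- Its support thus lies in `[a, b]`, which is inside `(0, ℓ)`.
  obtain ⟨a, ha⟩ := h.hasCompactSupport.isCompact.exists_isLeast hne
  obtain ⟨b, hb⟩ := h.hasCompactSupport.isCompact.exists_isGreatest hne
  have hint : Integrable φ := h.contDiff.continuous.integrable_of_hasCompactSupport
    h.hasCompactSupport
  have hd : ∀ x, HasDerivAt (fun x => ∫ t in a..x, φ t) (φ x) x := fun x =>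
    intervalIntegral.integral_hasDerivAt_right (h.contDiff.continuous.intervalIntegrable _ _)
      (h.contDiff.continuous.stronglyMeasurableAtFilter _ _)
      h.contDiff.continuous.continuousAt
  have hderiv : _root_.deriv (fun x => ∫ t in a..x, φ t) = φ := funext fun x => (hd x).deriv
  have hlt : ∀ x, x < a → φ x = 0 := fun x hx =>
    image_eq_zero_of_notMem_tsupport fun h' => not_lt.2 (ha.2 h') hx
  have hgt : ∀ x, b < x → φ x = 0 := fun x hx =>
    image_eq_zero_of_notMem_tsupport fun h' => not_lt.2 (hb.2 h') hx
  have hs : Function.support (fun x => ∫ t in a..x, φ t) ⊆ Set.Icc a b := by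
    intro x hx
    by_contra hn
    refine hx ?_
    simp only
    rcases lt_or_ge x a with hxa | hxa
    · rw [intervalIntegral.integral_of_ge hxa.le, integral_Ioc_eq_integral_Ioo,
        setIntegral_congr_fun (g := fun _ => (0 : ℝ)) measurableSet_Ioo (fun t ht => hlt t ht.2)]
      simp
    · have hxb : b < x := by
        by_contra hh
        exact hn ⟨hxa, not_lt.1 hh⟩
      rw [intervalIntegral.integral_of_le hxa, ← integral_Icc_eq_integral_Ioc, ← h0]
      refine setIntegral_eq_integral_of_forall_compl_eq_zero fun t ht => ?_
      rcases lt_or_ge t a with hta | hta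
      · exact hlt t hta
      · refine hgt t (hxb.trans ?_)
        by_contra hh
        exact ht ⟨hta, not_lt.1 hh⟩
  have hts : tsupport (fun x => ∫ t in a..x, φ t) ⊆ Set.Icc a b := closure_minimal hs isClosed_Icc
  refine ⟨fun x => ∫ t in a..x, φ t, ⟨?_, ?_, ?_⟩, hderiv⟩
  · exact contDiff_infty_iff_deriv.2 ⟨fun x => (hd x).differentiableAt, by
      rw [hderiv]; exact h.contDiff⟩
  · exact isCompact_Icc.of_isClosed_subset (isClosed_tsupport _) hts
  · have h1 := h.tsupport_subset ha.1
    have h2 := h.tsupport_subset hb.1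
    exact hts.trans fun x hx => ⟨h1.1.trans_le hx.1, hx.2.trans_lt h2.2⟩

lemma exists_integral_eq_one (hℓ : 0 < ℓ) : ∃ φ, IsTest ℓ φ ∧ ∫ x, φ x = 1 := by
  let B : ContDiffBump (ℓ / 2) := ⟨ℓ / 8, ℓ / 4, by positivity, by linarith⟩
  refine ⟨B.normed volume, ⟨B.contDiff_normed, B.hasCompactSupport_normed, ?_⟩,
    B.integral_normed⟩
  rw [B.tsupport_normed_eq, Real.closedBall_eq_Icc]
  intro x hx
  have h1 : ℓ / 2 - ℓ / 4 ≤ x := hx.1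
  have h2 : x ≤ ℓ / 2 + ℓ / 4 := hx.2
  constructor <;> linarith

/-- The class in `L²(0, ℓ)` of the `n`-th derivative of a test function. -/
def toL2 (h : IsTest ℓ φ) (n : ℕ) : L2I ℓ :=
  ofCont (fun x => ((_root_.iteratedDeriv n φ x : ℝ) : ℂ))
    (Complex.continuous_ofReal.comp (h.iteratedDeriv n).contDiff.continuous)

lemma coeFn_toL2 (h : IsTest ℓ φ) (n : ℕ) :
    h.toL2 n =ᵐ[volume.restrict (Set.Ioo (0 : ℝ) ℓ)]
      fun x => ((_root_.iteratedDeriv n φ x : ℝ) : ℂ) :=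
  coeFn_ofCont _ _

lemma inner_toL2 (h : IsTest ℓ φ) (n : ℕ) (f : L2I ℓ) :
    inner ℂ (h.toL2 n) f =
      ∫ x in Set.Ioo (0 : ℝ) ℓ, ((_root_.iteratedDeriv n φ x : ℝ) : ℂ) * f x := by
  rw [inner_L2I]
  refine integral_congr_ae ?_
  filter_upwards [h.coeFn_toL2 n] with x hx
  rw [hx, Complex.conj_ofReal]

lemma toL2_sub_const_smul (h : IsTest ℓ φ) (h' : IsTest ℓ ψ) (c : ℝ) (n : ℕ) :
    (h.sub_const_smul h' c).toL2 n = h.toL2 n - (c : ℂ) • h'.toL2 n := by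
  refine Lp.ext ?_
  filter_upwards [Lp.coeFn_sub (h.toL2 n) ((c : ℂ) • h'.toL2 n),
    Lp.coeFn_smul (c : ℂ) (h'.toL2 n), h.coeFn_toL2 n, h'.coeFn_toL2 n,
    (h.sub_const_smul h' c).coeFn_toL2 n] with x h1 h2 h3 h4 h5
  have e : _root_.iteratedDeriv n (φ - c • ψ) x =
      _root_.iteratedDeriv n φ x - c * _root_.iteratedDeriv n ψ x := by
    have hφ := (h.contDiff.contDiffAt (x := x)).of_le (m := n) (by exact_mod_cast le_top)
    have hψ := (h'.contDiff.contDiffAt (x := x)).of_le (m := n) (by exact_mod_cast le_top)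
    have hψ' : ContDiffAt ℝ n (c • ψ) x := hψ.const_smul c
    rw [iteratedDeriv_sub hφ hψ', iteratedDeriv_const_smul_field]
    simp
  rw [h1, Pi.sub_apply, h2, Pi.smul_apply, h3, h4, h5, e]
  simp

lemma toL2_deriv (h : IsTest ℓ φ) (n : ℕ) : h.deriv.toL2 n = h.toL2 (n + 1) := by
  simp only [toL2, iteratedDeriv_succ']

lemma toL2_iteratedDeriv (h : IsTest ℓ φ) (n m : ℕ) :
    (h.iteratedDeriv m).toL2 n = h.toL2 (n + m) := by
  simp only [toL2, iteratedDeriv_eq_iterate, Function.iterate_add_apply]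

lemma toL2_zero_eq_prim (h : IsTest ℓ φ) :
    h.toL2 0 = prim 0 (h.toL2 1) ∧ ∀ x ∈ Set.Icc 0 ℓ, primFun 0 (h.toL2 1) x = φ x := by
  have h0 : φ 0 = 0 := h.eq_zero (by simp)
  have key := ofCont_eq_prim (ℓ := ℓ) (p := fun x => (φ x : ℂ))
    (p' := fun x => ((_root_.iteratedDeriv 1 φ x : ℝ) : ℂ))
    (Complex.continuous_ofReal.comp (h.iteratedDeriv 1).contDiff.continuous)
    (fun x => by
      rw [iteratedDeriv_one]
      exact (h.hasDerivAt x).ofReal_comp)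
  simp only [h0, Complex.ofReal_zero] at key
  refine ⟨?_, key.2⟩
  simp only [toL2, iteratedDeriv_zero]
  exact key.1

end IsTest

/-! ### Weak derivatives -/

/-- Test functions are real, so the conjugation in the inner product has no effect on them. In this
form, linearity and stability under limits of weak derivatives are properties of the inner product.
-/
lemma isWeakDeriv_iff {n : ℕ} {f g : L2I ℓ} : IsWeakDeriv ℓ n f g ↔
    ∀ (φ : ℝ → ℝ) (h : IsTest ℓ φ),
      inner ℂ (h.toL2 n) f = (-1 : ℂ) ^ n * inner ℂ (h.toL2 0) g := by
  constructor
  · intro H φ h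
    rw [h.inner_toL2, h.inner_toL2, H φ h.1 h.2 h.3]
    simp
  · intro H φ h1 h2 h3
    have := H φ ⟨h1, h2, h3⟩
    rw [IsTest.inner_toL2, IsTest.inner_toL2] at this
    simpa using this

lemma eq_zero_of_inner_toL2_eq_zero {f : L2I ℓ}
    (H : ∀ (φ : ℝ → ℝ) (h : IsTest ℓ φ), inner ℂ (h.toL2 0) f = 0) : f = 0 := by
  have key := isOpen_Ioo.ae_eq_zero_of_integral_contDiff_smul_eq_zero (U := Set.Ioo (0 : ℝ) ℓ)
    (f := f) (μ := volume) (integrableOn_coeFn f).locallyIntegrableOn ?_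
  · refine (Lp.eq_zero_iff_ae_eq_zero).2 ((ae_restrict_iff' measurableSet_Ioo).2 key)
  · intro φ h1 h2 h3
    have h : IsTest ℓ φ := ⟨h1, h2, h3⟩
    have := H φ h
    rw [h.inner_toL2] at this
    rw [← setIntegral_eq_integral_of_forall_compl_eq_zero (s := Set.Ioo (0 : ℝ) ℓ)
      (fun x hx => by rw [h.eq_zero hx, zero_smul]), ← this]
    simp

namespace IsWeakDeriv

variable {n m : ℕ} {f g k f' g' : L2I ℓ}

lemma unique (h : IsWeakDeriv ℓ n f g) (h' : IsWeakDeriv ℓ n f g') : g = g' := by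
  rw [isWeakDeriv_iff] at h h'
  rw [← sub_eq_zero]
  refine eq_zero_of_inner_toL2_eq_zero fun φ hφ => ?_
  rw [inner_sub_right, sub_eq_zero]
  refine mul_left_cancel₀ (pow_ne_zero n (by norm_num : (-1 : ℂ) ≠ 0)) ?_
  rw [← h φ hφ, ← h' φ hφ]

lemma add (h : IsWeakDeriv ℓ n f g) (h' : IsWeakDeriv ℓ n f' g') :
    IsWeakDeriv ℓ n (f + f') (g + g') := by
  rw [isWeakDeriv_iff] at *
  intro φ hφ
  rw [inner_add_right, inner_add_right, h φ hφ, h' φ hφ, mul_add]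

lemma smul (h : IsWeakDeriv ℓ n f g) (c : ℂ) : IsWeakDeriv ℓ n (c • f) (c • g) := by
  rw [isWeakDeriv_iff] at *
  intro φ hφ
  rw [inner_smul_right, inner_smul_right, h φ hφ]
  ring

/-- If `φ` is a test function then so is its derivative of order `m`; it can be used to test the
first relation. -/
lemma comp (h : IsWeakDeriv ℓ n f g) (h' : IsWeakDeriv ℓ m g k) :
    IsWeakDeriv ℓ (n + m) f k := by
  rw [isWeakDeriv_iff] at *
  intro φ hφ
  rw [← hφ.toL2_iteratedDeriv, h _ (hφ.iteratedDeriv m), hφ.toL2_iteratedDeriv, zero_add, h' φ hφ]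
  ring

lemma refl (f : L2I ℓ) : IsWeakDeriv ℓ 0 f f := by
  rw [isWeakDeriv_iff]
  simp

lemma weakDeriv_eq (h : IsWeakDeriv ℓ n f g) : weakDeriv n f = g := by
  have hex : ∃ g, IsWeakDeriv ℓ n f g := ⟨g, h⟩
  rw [weakDeriv, dif_pos hex]
  exact hex.choose_spec.unique h

lemma tendsto {x y : ℕ → L2I ℓ} (h : ∀ k, IsWeakDeriv ℓ n (x k) (y k))
    (hx : Tendsto x atTop (𝓝 f)) (hy : Tendsto y atTop (𝓝 g)) : IsWeakDeriv ℓ n f g := by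
  rw [isWeakDeriv_iff]
  intro φ hφ
  have h1 : Tendsto (fun k => inner ℂ (hφ.toL2 n) (x k)) atTop (𝓝 (inner ℂ (hφ.toL2 n) f)) :=
    tendsto_const_nhds.inner hx
  have h2 : Tendsto (fun k => (-1 : ℂ) ^ n * inner ℂ (hφ.toL2 0) (y k)) atTop
      (𝓝 ((-1 : ℂ) ^ n * inner ℂ (hφ.toL2 0) g)) :=
    (tendsto_const_nhds.inner hy).const_mul _
  refine tendsto_nhds_unique h1 (h2.congr fun k => ?_)
  rw [(isWeakDeriv_iff.1 (h k)) φ hφ]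

end IsWeakDeriv

/-- The boundary terms of the integration by parts vanish with the test function at `0` and `ℓ`. -/
lemma isWeakDeriv_prim (hℓ : 0 ≤ ℓ) (c : ℂ) (g : L2I ℓ) : IsWeakDeriv ℓ 1 (prim c g) g := by
  rw [isWeakDeriv_iff]
  intro φ hφ
  have key := inner_prim_add_inner_prim hℓ 0 c (hφ.toL2 1) g
  rw [← hφ.toL2_zero_eq_prim.1, hφ.toL2_zero_eq_prim.2 ℓ ⟨hℓ, le_rfl⟩,
    hφ.eq_zero (x := ℓ) (by simp)] at key
  simp only [Complex.ofReal_zero, map_zero, zero_mul, sub_zero] at key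
  linear_combination key

lemma inner_toL2_prim {φ : ℝ → ℝ} (h : IsTest ℓ φ) (c : ℂ) (g : L2I ℓ) :
    inner ℂ (h.toL2 0) (prim c g) = inner ℂ (h.toL2 0) (prim 0 g) + ((∫ x, φ x : ℝ) : ℂ) * c := by
  have e : (prim c g : L2I ℓ) = prim 0 g + ofCont (fun _ => c) continuous_const := by
    refine Lp.ext ?_
    filter_upwards [coeFn_prim c g, Lp.coeFn_add (prim 0 g : L2I ℓ)
      (ofCont (fun _ => c) continuous_const), coeFn_prim 0 g,
      coeFn_ofCont (ℓ := ℓ) (fun _ => c) continuous_const] with x h1 h2 h3 h4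
    rw [h1, h2, Pi.add_apply, h3, h4]
    simp [primFun, add_comm]
  rw [e, inner_add_right]
  congr 1
  rw [h.inner_toL2, ← setIntegral_eq_integral_of_forall_compl_eq_zero
    (s := Set.Ioo (0 : ℝ) ℓ) (fun x hx => h.eq_zero hx), ← integral_complex_ofReal,
    ← integral_mul_const]
  refine integral_congr_ae ?_
  filter_upwards [coeFn_ofCont (ℓ := ℓ) (fun _ => c) continuous_const] with x hx
  rw [hx]
  simp

/-- The lemma of du Bois-Reymond: a weak derivative of order `n + 1` is the derivative of a weak
derivative of order `n`, which is absolutely continuous. -/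
lemma IsWeakDeriv.exists_prim (hℓ : 0 < ℓ) {n : ℕ} {f g : L2I ℓ} (H : IsWeakDeriv ℓ (n + 1) f g) :
    ∃ c, IsWeakDeriv ℓ n f (prim c g) := by
  obtain ⟨φ₀, h₀, hone⟩ := IsTest.exists_integral_eq_one hℓ
  rw [isWeakDeriv_iff] at H
  have hp := isWeakDeriv_iff.1 (isWeakDeriv_prim hℓ.le 0 g)
  -- This constant is forced: it is what the claim yields when tested against `φ₀`, whose integral
  -- is one.
  refine ⟨(-1 : ℂ) ^ n * inner ℂ (h₀.toL2 n) f - inner ℂ (h₀.toL2 0) (prim 0 g),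
    isWeakDeriv_iff.2 fun ψ hψ => ?_⟩
  set I := ∫ x, ψ x with hI
  -- Subtracting `I • φ₀` removes the integral of `ψ`, so the difference is `χ'` for a test function
  -- `χ`. Testing `H` with `χ` gives the claim up to multiples of the identity for `φ₀`.
  have hζ := hψ.sub_const_smul h₀ I
  have hζ0 : ∫ x, (ψ - I • φ₀) x = 0 := by
    have i1 : Integrable ψ := hψ.contDiff.continuous.integrable_of_hasCompactSupport
      hψ.hasCompactSupport
    have i2 : Integrable φ₀ := h₀.contDiff.continuous.integrable_of_hasCompactSupport
      h₀.hasCompactSupport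
    simp only [Pi.sub_apply, Pi.smul_apply, smul_eq_mul]
    rw [integral_sub i1 (i2.const_mul I), integral_const_mul, hone, ← hI]
    ring
  obtain ⟨χ, hχ, hd⟩ := hζ.exists_deriv_eq hζ0
  have e : ∀ k, hχ.toL2 (k + 1) = hψ.toL2 k - (I : ℂ) • h₀.toL2 k := by
    intro k
    rw [← hψ.toL2_sub_const_smul h₀, ← hχ.toL2_deriv]
    simp only [IsTest.toL2, hd]
  have k1 := H χ hχ
  have k2 := hp χ hχ
  rw [e, inner_sub_left, inner_smul_left] at k1
  rw [show (1 : ℕ) = 0 + 1 from rfl, e, inner_sub_left, inner_smul_left] at k2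
  simp only [Complex.conj_ofReal] at k1 k2
  rw [inner_toL2_prim hψ _ g, ← hI]
  have sq : ((-1 : ℂ) ^ n) * (-1) ^ n = 1 := by rw [← mul_pow]; simp
  linear_combination k1 - (-1 : ℂ) ^ n * k2 - (I * inner ℂ (h₀.toL2 n) f) * sq

/-! ### Sobolev functions and their boundary values -/

/-- The highest weak derivative alone yields all lower ones, by repeated use of `exists_prim`.
Regularity of the operator domain therefore needs no separate estimates. -/
lemma IsWeakDeriv.memH (hℓ : 0 < ℓ) {n : ℕ} {f g : L2I ℓ} (H : IsWeakDeriv ℓ n f g) :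
    MemH n f := by
  induction n generalizing g with
  | zero =>
    intro m hm
    obtain rfl : m = 0 := by omega
    exact ⟨g, H⟩
  | succ n ih =>
    intro m hm
    rcases Nat.lt_or_ge m (n + 1) with h | h
    · obtain ⟨c, hc⟩ := H.exists_prim hℓ
      exact ih hc m (by omega)
    · obtain rfl : m = n + 1 := by omega
      exact ⟨g, H⟩

namespace MemH

variable {n m : ℕ} {f g : L2I ℓ}

lemma mono (h : MemH n f) (hm : m ≤ n) : MemH m f := fun k hk => h k (hk.trans hm)

lemma isWeakDeriv (h : MemH n f) : IsWeakDeriv ℓ n f (weakDeriv n f) := by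
  obtain ⟨g, hg⟩ := h n le_rfl
  rwa [hg.weakDeriv_eq]

lemma add (hf : MemH n f) (hg : MemH n g) : MemH n (f + g) := fun _ hm =>
  ⟨_, (hf.mono hm).isWeakDeriv.add (hg.mono hm).isWeakDeriv⟩

lemma smul (hf : MemH n f) (c : ℂ) : MemH n (c • f) := fun _ hm =>
  ⟨_, (hf.mono hm).isWeakDeriv.smul c⟩

lemma weakDeriv_add (hf : MemH n f) (hg : MemH n g) :
    weakDeriv n (f + g) = weakDeriv n f + weakDeriv n g :=
  (hf.isWeakDeriv.add hg.isWeakDeriv).weakDeriv_eq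

lemma weakDeriv_smul (hf : MemH n f) (c : ℂ) : weakDeriv n (c • f) = c • weakDeriv n f :=
  (hf.isWeakDeriv.smul c).weakDeriv_eq

end MemH

lemma weakDeriv_zero (f : L2I ℓ) : weakDeriv 0 f = f := (IsWeakDeriv.refl f).weakDeriv_eq

/-- Continuous functions that agree almost everywhere on `(0, ℓ)` agree on `[0, ℓ]`, so the choice
made in `contRep` does not affect boundary values. -/
lemma contRep_eqOn (hℓ : 0 < ℓ) {f : L2I ℓ} {F : ℝ → ℂ} (hF : ContinuousOn F (Set.Icc 0 ℓ))
    (h : f =ᵐ[volume.restrict (Set.Ioo (0 : ℝ) ℓ)] F) :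
    Set.EqOn (contRep f) F (Set.Icc 0 ℓ) := by
  have hex : ∃ F : ℝ → ℂ, ContinuousOn F (Set.Icc 0 ℓ) ∧
    f =ᵐ[volume.restrict (Set.Ioo (0 : ℝ) ℓ)] F := ⟨F, hF, h⟩
  rw [contRep, dif_pos hex]
  refine Measure.eqOn_Icc_of_ae_eq volume hℓ.ne ?_ hex.choose_spec.1 hF
  rw [← restrict_Ioo_eq_restrict_Icc]
  exact hex.choose_spec.2.symm.trans h

lemma contRep_prim (hℓ : 0 < ℓ) (c : ℂ) (g : L2I ℓ) {x : ℝ} (hx : x ∈ Set.Icc 0 ℓ) :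
    contRep (prim c g : L2I ℓ) x = primFun c g x :=
  contRep_eqOn hℓ (continuous_primFun c g).continuousOn (coeFn_prim c g) hx

namespace MemH

variable {n m : ℕ} {f g : L2I ℓ}

lemma exists_prim (hℓ : 0 < ℓ) (h : MemH (n + 1) f) :
    ∃ c, weakDeriv n f = prim c (weakDeriv (n + 1) f) := by
  obtain ⟨c, hc⟩ := h.isWeakDeriv.exists_prim hℓ
  exact ⟨c, hc.weakDeriv_eq⟩

lemma endValue_add (hℓ : 0 < ℓ) (hf : MemH (n + 1) f) (hg : MemH (n + 1) g) {x : ℝ}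
    (hx : x ∈ Set.Icc 0 ℓ) : endValue n (f + g) x = endValue n f x + endValue n g x := by
  obtain ⟨c, hc⟩ := hf.exists_prim hℓ
  obtain ⟨d, hd⟩ := hg.exists_prim hℓ
  simp only [endValue]
  rw [(hf.mono n.le_succ).weakDeriv_add (hg.mono n.le_succ), hc, hd, contRep_prim hℓ _ _ hx,
    contRep_prim hℓ _ _ hx]
  refine contRep_eqOn hℓ (F := fun x => primFun c (weakDeriv (n + 1) f) x +
    primFun d (weakDeriv (n + 1) g) x)
    ((continuous_primFun _ _).add (continuous_primFun _ _)).continuousOn ?_ hx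
  filter_upwards [Lp.coeFn_add (prim c (weakDeriv (n + 1) f)) (prim d (weakDeriv (n + 1) g)),
    coeFn_prim c (weakDeriv (n + 1) f), coeFn_prim d (weakDeriv (n + 1) g)] with x h1 h2 h3
  rw [h1, Pi.add_apply, h2, h3]

lemma endValue_smul (hℓ : 0 < ℓ) (hf : MemH (n + 1) f) (r : ℂ) {x : ℝ}
    (hx : x ∈ Set.Icc 0 ℓ) : endValue n (r • f) x = r * endValue n f x := by
  obtain ⟨c, hc⟩ := hf.exists_prim hℓ
  simp only [endValue]
  rw [(hf.mono n.le_succ).weakDeriv_smul, hc, contRep_prim hℓ _ _ hx]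
  refine contRep_eqOn hℓ (F := fun x => r * primFun c (weakDeriv (n + 1) f) x)
    (continuous_const.mul (continuous_primFun _ _)).continuousOn ?_ hx
  filter_upwards [Lp.coeFn_smul r (prim c (weakDeriv (n + 1) f)),
    coeFn_prim c (weakDeriv (n + 1) f)] with x h1 h2
  rw [h1, Pi.smul_apply, h2, smul_eq_mul]

/-- Integration by parts for Sobolev functions. -/
lemma inner_weakDeriv_succ (hℓ : 0 < ℓ) (hf : MemH (n + 1) f) (hg : MemH (m + 1) g) :
    inner ℂ (weakDeriv (n + 1) f) (weakDeriv m g) + inner ℂ (weakDeriv n f) (weakDeriv (m + 1) g) =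
      (starRingEnd ℂ) (endValue n f ℓ) * endValue m g ℓ -
        (starRingEnd ℂ) (endValue n f 0) * endValue m g 0 := by
  obtain ⟨c, hc⟩ := hf.exists_prim hℓ
  obtain ⟨d, hd⟩ := hg.exists_prim hℓ
  have h0 : (0 : ℝ) ∈ Set.Icc 0 ℓ := ⟨le_rfl, hℓ.le⟩
  have h1 : ℓ ∈ Set.Icc 0 ℓ := ⟨hℓ.le, le_rfl⟩
  simp only [endValue]
  rw [hc, hd, inner_prim_add_inner_prim hℓ.le, contRep_prim hℓ _ _ h0, contRep_prim hℓ _ _ h0,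
    contRep_prim hℓ _ _ h1, contRep_prim hℓ _ _ h1, primFun_zero, primFun_zero]

end MemH

/-! ### Polynomials as elements of `L²(0, ℓ)` -/

/-- The class of a polynomial in `L²(0, ℓ)`. -/
def ofPoly (P : Polynomial ℂ) : L2I ℓ :=
  ofCont (fun x => P.eval (x : ℂ)) (P.continuous.comp Complex.continuous_ofReal)

lemma ofPoly_eq_prim (P : Polynomial ℂ) :
    (ofPoly P : L2I ℓ) = prim (P.eval 0) (ofPoly P.derivative) ∧
      ∀ x ∈ Set.Icc 0 ℓ, primFun (P.eval 0) (ofPoly P.derivative : L2I ℓ) x = P.eval (x : ℂ) := by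
  have := ofCont_eq_prim (ℓ := ℓ) (p := fun x => P.eval (x : ℂ))
    (p' := fun x => P.derivative.eval (x : ℂ))
    (P.derivative.continuous.comp Complex.continuous_ofReal)
    (fun x => (P.hasDerivAt (x : ℂ)).comp_ofReal)
  simp only [Complex.ofReal_zero] at this
  exact this

lemma isWeakDeriv_ofPoly (hℓ : 0 < ℓ) (P : Polynomial ℂ) (n : ℕ) :
    IsWeakDeriv ℓ n (ofPoly P) (ofPoly (Polynomial.derivative^[n] P)) := by
  induction n with
  | zero => exact IsWeakDeriv.refl _
  | succ n ih =>
    refine ih.comp ?_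
    rw [Function.iterate_succ_apply', (ofPoly_eq_prim (Polynomial.derivative^[n] P)).1]
    exact isWeakDeriv_prim hℓ.le _ _

lemma memH_ofPoly (hℓ : 0 < ℓ) (P : Polynomial ℂ) (n : ℕ) : MemH n (ofPoly P : L2I ℓ) :=
  (isWeakDeriv_ofPoly hℓ P n).memH hℓ

lemma weakDeriv_ofPoly (hℓ : 0 < ℓ) (P : Polynomial ℂ) (n : ℕ) :
    weakDeriv n (ofPoly P : L2I ℓ) = ofPoly (Polynomial.derivative^[n] P) :=
  (isWeakDeriv_ofPoly hℓ P n).weakDeriv_eq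

lemma endValue_ofPoly (hℓ : 0 < ℓ) (P : Polynomial ℂ) (n : ℕ) {x : ℝ} (hx : x ∈ Set.Icc 0 ℓ) :
    endValue n (ofPoly P : L2I ℓ) x = (Polynomial.derivative^[n] P).eval (x : ℂ) := by
  rw [endValue, weakDeriv_ofPoly hℓ, (ofPoly_eq_prim _).1, contRep_prim hℓ _ _ hx,
    (ofPoly_eq_prim _).2 x hx]

/-- Cubic Hermite interpolation. -/
lemma exists_hermite (hℓ : 0 < ℓ) (α β γ δ : ℂ) : ∃ P : Polynomial ℂ,
    P.eval 0 = α ∧ P.derivative.eval 0 = β ∧ P.eval (ℓ : ℂ) = γ ∧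
      P.derivative.eval (ℓ : ℂ) = δ := by
  have h : (ℓ : ℂ) ≠ 0 := by exact_mod_cast hℓ.ne'
  -- `A` and `B` are the errors in value and slope at `ℓ` left by the linear part `α + β x`. The
  -- coefficients of `x²` and `x³` solve the 2×2 system that corrects both.
  let A := γ - α - β * ℓ
  let B := δ - β
  refine ⟨.C α + .C β * .X + .C ((3 * A - B * ℓ) / ℓ ^ 2) * .X ^ 2 +
    .C ((B * ℓ - 2 * A) / ℓ ^ 3) * .X ^ 3, by simp, by simp, ?_, ?_⟩
  · simp only [Polynomial.eval_add, Polynomial.eval_mul, Polynomial.eval_C, Polynomial.eval_X,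
      Polynomial.eval_pow, A, B]
    field_simp
    ring
  · simp [A, B]
    field_simp
    ring

/-- An element of `L²(0, ℓ)` that is smooth up to the endpoints, with prescribed values and
derivatives there. -/
lemma exists_memH_endValue (hℓ : 0 < ℓ) (α β γ δ : ℂ) : ∃ f : L2I ℓ, (∀ n, MemH n f) ∧
    endValue 0 f 0 = α ∧ endValue 1 f 0 = β ∧ endValue 0 f ℓ = γ ∧ endValue 1 f ℓ = δ := by
  obtain ⟨P, h1, h2, h3, h4⟩ := exists_hermite hℓ α β γ δ
  have h0 : (0 : ℝ) ∈ Set.Icc 0 ℓ := ⟨le_rfl, hℓ.le⟩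
  have hl : ℓ ∈ Set.Icc 0 ℓ := ⟨hℓ.le, le_rfl⟩
  refine ⟨ofPoly P, memH_ofPoly hℓ P, ?_, ?_, ?_, ?_⟩
  · rw [endValue_ofPoly hℓ _ _ h0]; simpa using h1
  · rw [endValue_ofPoly hℓ _ _ h0]; simpa using h2
  · rw [endValue_ofPoly hℓ _ _ hl]; simpa using h3
  · rw [endValue_ofPoly hℓ _ _ hl]; simpa using h4

/-! ### The form `⟪T x, T y⟫` and the operator `T* T` of a closed operator `T` -/

section ClosedOperator

variable {𝓗 𝓚 : Type*} [NormedAddCommGroup 𝓗] [InnerProductSpace ℂ 𝓗]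
  [NormedAddCommGroup 𝓚] [InnerProductSpace ℂ 𝓚] [CompleteSpace 𝓚]

/-- A sequence that is Cauchy for the form has Cauchy images under `T`. Completeness of `𝓚` gives
these a limit, and the closed graph identifies it with the image of `y`. -/
lemma isClosedNonnegForm_of_isClosed (T : 𝓗 →ₗ.[ℂ] 𝓚) (hT : T.IsClosed)
    (hd : Dense (T.domain : Set 𝓗)) (h : 𝓗 → 𝓗 → ℂ)
    (hh : ∀ x y : T.domain, h x y = inner ℂ (T x) (T y)) :
    IsClosedNonnegForm (T.domain : Set 𝓗) h where
  zero_mem := T.domain.zero_mem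
  add_mem _ hx _ hy := T.domain.add_mem hx hy
  smul_mem r _ hx := T.domain.smul_mem r hx
  dense := hd
  add_right x hx y hy z hz := by
    have := hh ⟨x, hx⟩ (⟨y, hy⟩ + ⟨z, hz⟩)
    rw [T.map_add, inner_add_right, ← hh, ← hh] at this
    exact this
  smul_right x hx y hy r := by
    have := hh ⟨x, hx⟩ (r • ⟨y, hy⟩)
    rw [T.map_smul, inner_smul_right, ← hh] at this
    exact this
  symm x hx y hy := by
    rw [hh ⟨x, hx⟩ ⟨y, hy⟩, hh ⟨y, hy⟩ ⟨x, hx⟩, inner_conj_symm]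
  nonneg x hx := by
    rw [hh ⟨x, hx⟩ ⟨x, hx⟩]
    exact inner_self_nonneg (𝕜 := ℂ)
  closed x y hx hy hc := by
    have hdiff : ∀ a b : T.domain, h ((a : 𝓗) - b) ((a : 𝓗) - b) = ((‖T a - T b‖ ^ 2 : ℝ) : ℂ) := by
      intro a b
      have := hh (a - b) (a - b)
      rw [T.map_sub, inner_self_eq_norm_sq_to_K] at this
      simpa using this
    have hcau : CauchySeq fun n => T ⟨x n, hx n⟩ := by
      rw [Metric.cauchySeq_iff]
      intro ε hε
      obtain ⟨N, hN⟩ := hc (ε ^ 2) (by positivity)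
      refine ⟨N, fun m hm n hn => ?_⟩
      have := hN m hm n hn
      rw [hdiff ⟨x m, hx m⟩ ⟨x n, hx n⟩, Complex.norm_real, Real.norm_of_nonneg (by positivity)]
        at this
      rw [dist_eq_norm]
      exact lt_of_pow_lt_pow_left₀ 2 hε.le this
    obtain ⟨θ, hθ⟩ := cauchySeq_tendsto_of_complete hcau
    have hmem : (y, θ) ∈ T.graph :=
      hT.mem_of_tendsto (hy.prodMk_nhds hθ) (Eventually.of_forall fun n => T.mem_graph ⟨x n, hx n⟩)
    obtain ⟨y', rfl, rfl⟩ := T.mem_graph_iff.1 hmem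
    refine ⟨y'.2, ?_⟩
    have h0 : Tendsto (fun n => ‖T ⟨x n, hx n⟩ - T y'‖ ^ 2) atTop (𝓝 0) := by
      simpa using ((tendsto_iff_norm_sub_tendsto_zero.1 hθ).pow 2)
    have h1 := (Complex.continuous_ofReal.tendsto 0).comp h0
    rw [Complex.ofReal_zero] at h1
    exact h1.congr fun n => (hdiff ⟨x n, hx n⟩ y').symm

/-- Solvability of `x + T* T x = y`. -/
lemma exists_inner_sub_eq [CompleteSpace 𝓗] (T : 𝓗 →ₗ.[ℂ] 𝓚) (hT : T.IsClosed) (y : 𝓗) :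
    ∃ x : T.domain, ∀ z : T.domain, inner ℂ (T z) (T x) = inner ℂ (z : 𝓗) (y - x) := by
  -- The graph is moved to the Hilbert space product, since the plain product carries the sup norm.
  -- The orthogonal projection of `(y, 0)` onto it is `(x, T x)`; orthogonality of the remainder `(y
  -- - x, -T x)` to the graph is the equation sought.
  let G : Submodule ℂ (WithLp 2 (𝓗 × 𝓚)) :=
    T.graph.comap (WithLp.linearEquiv 2 ℂ (𝓗 × 𝓚)).toLinearMap
  have hG : IsClosed (G : Set (WithLp 2 (𝓗 × 𝓚))) :=
    IsClosed.preimage (WithLp.prod_continuous_ofLp 2 𝓗 𝓚) hT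
  have : CompleteSpace G := hG.completeSpace_coe
  obtain ⟨p, hp, q, hq, hpq⟩ := G.exists_add_mem_mem_orthogonal (WithLp.toLp 2 (y, (0 : 𝓚)))
  obtain ⟨x, hx1, hx2⟩ := T.mem_graph_iff.1 (show (p.fst, p.snd) ∈ T.graph from hp)
  refine ⟨x, fun z => ?_⟩
  have hz : WithLp.toLp 2 ((z : 𝓗), T z) ∈ G := T.mem_graph z
  have key := (Submodule.mem_orthogonal _ _).1 hq _ hz
  have hq' : q = WithLp.toLp 2 (y, (0 : 𝓚)) - p := by rw [hpq]; abel
  rw [hq', WithLp.prod_inner_apply] at key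
  simp only [WithLp.ofLp_sub, Prod.fst_sub, Prod.snd_sub] at key
  change inner ℂ (z : 𝓗) (y - p.fst) + inner ℂ (T z) (0 - p.snd) = 0 at key
  simp only at hx1 hx2
  rw [← hx1, ← hx2, zero_sub, inner_neg_right] at key
  linear_combination -key

/-- The operator associated with the form of a closed densely defined operator is self-adjoint. -/
theorem exists_isSelfAdjoint_isAssociatedOperator [CompleteSpace 𝓗]
    (T : 𝓗 →ₗ.[ℂ] 𝓚) (hT : T.IsClosed)
    (hd : Dense (T.domain : Set 𝓗)) (h : 𝓗 → 𝓗 → ℂ)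
    (hh : ∀ x y : T.domain, h x y = inner ℂ (T x) (T y)) :
    ∃ H : 𝓗 →ₗ.[ℂ] 𝓗, Dense (H.domain : Set 𝓗) ∧ IsSelfAdjoint H ∧
      IsAssociatedOperator (T.domain : Set 𝓗) h H := by
  let g : Submodule ℂ (𝓗 × 𝓗) :=
    { carrier := {p | ∃ hx : p.1 ∈ T.domain, ∀ z : T.domain,
        inner ℂ (T z) (T ⟨p.1, hx⟩) = inner ℂ (z : 𝓗) p.2}
      zero_mem' := ⟨T.domain.zero_mem, fun z => by
        have : T ⟨(0 : 𝓗 × 𝓗).1, T.domain.zero_mem⟩ = 0 := T.map_zero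
        rw [this]; simp⟩
      add_mem' := by
        rintro p q ⟨hp, hp'⟩ ⟨hq, hq'⟩
        refine ⟨T.domain.add_mem hp hq, fun z => ?_⟩
        have : T ⟨(p + q).1, T.domain.add_mem hp hq⟩ = T ⟨p.1, hp⟩ + T ⟨q.1, hq⟩ := by
          rw [← T.map_add]; rfl
        rw [this, inner_add_right, hp', hq', Prod.snd_add, inner_add_right]
      smul_mem' := by
        rintro r p ⟨hp, hp'⟩
        refine ⟨T.domain.smul_mem r hp, fun z => ?_⟩
        have : T ⟨(r • p).1, T.domain.smul_mem r hp⟩ = r • T ⟨p.1, hp⟩ := by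
          rw [← T.map_smul]; rfl
        rw [this, inner_smul_right, hp', Prod.smul_snd, inner_smul_right] }
  -- Density of the domain of `T` makes the relation `g` single-valued, hence the graph of an
  -- operator.
  have hg : ∀ p ∈ g, p.1 = 0 → p.2 = 0 := by
    rintro ⟨x, y⟩ ⟨hx, hxy⟩ rfl
    have h0 : T ⟨0, hx⟩ = 0 := T.map_zero
    refine hd.eq_zero_of_inner_right (𝕜 := ℂ) fun z hz => ?_
    simpa [h0] using (hxy ⟨z, hz⟩).symm
  have hgraph : g.toLinearPMap.graph = g := g.toLinearPMap_graph_eq hg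
  set H := g.toLinearPMap with hH
  have hspec : ∀ x : H.domain, ∃ hx : (x : 𝓗) ∈ T.domain, ∀ z : T.domain,
      inner ℂ (T z) (T ⟨x, hx⟩) = inner ℂ (z : 𝓗) (H x) := fun x => by
    have : ((x : 𝓗), H x) ∈ g := by rw [← hgraph]; exact H.mem_graph x
    exact this
  have hsurj : ∀ y : 𝓗, ∃ x : H.domain, H x = y - x := by
    intro y
    obtain ⟨x, hx⟩ := exists_inner_sub_eq T hT y
    have : ((x : 𝓗), y - x) ∈ H.graph := by
      rw [hgraph]; exact ⟨x.2, hx⟩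
    obtain ⟨x', h1, h2⟩ := H.mem_graph_iff.1 this
    exact ⟨x', by rw [h2]; simp only at h1; rw [h1]⟩
  have hsymm : H.IsFormalAdjoint H := by
    intro x y
    obtain ⟨hx, hx'⟩ := hspec x
    obtain ⟨hy, hy'⟩ := hspec y
    rw [← hy' ⟨x, hx⟩, ← inner_conj_symm, ← hx' ⟨y, hy⟩, inner_conj_symm]
  -- If `y` is orthogonal to the domain, write `y = x + H x` and pair with `x`: then `‖T x‖² + ‖x‖²
  -- = 0`, so `x` and with it `y` vanish.
  have hdense : Dense (H.domain : Set 𝓗) := by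
    rw [Submodule.dense_iff_topologicalClosure_eq_top, Submodule.topologicalClosure_eq_top_iff,
      Submodule.eq_bot_iff]
    intro y hy
    obtain ⟨x, hx⟩ := hsurj y
    obtain ⟨hxT, hx'⟩ := hspec x
    have h1 := (Submodule.mem_orthogonal _ _).1 hy x x.2
    have h2 := hx' ⟨x, hxT⟩
    rw [hx, inner_sub_right, h1, zero_sub, inner_self_eq_norm_sq_to_K,
      inner_self_eq_norm_sq_to_K] at h2
    have h3 : ‖T ⟨x, hxT⟩‖ ^ 2 = -‖(x : 𝓗)‖ ^ 2 := by exact_mod_cast h2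
    have h4 : (x : 𝓗) = 0 := by
      rw [← norm_eq_zero, ← sq_eq_zero_iff]
      nlinarith [sq_nonneg ‖T ⟨x, hxT⟩‖, sq_nonneg ‖(x : 𝓗)‖]
    have h5 : H x = 0 := by
      have : x = 0 := Subtype.ext h4
      rw [this, H.map_zero]
    rw [h5, h4, sub_zero] at hx
    exact hx.symm
  have hle : H ≤ H.adjoint := hsymm.le_adjoint hdense
  refine ⟨H, hdense, ?_, ?_⟩
  · rw [LinearPMap.isSelfAdjoint_def]
    refine (LinearPMap.eq_of_le_of_domain_eq hle (le_antisymm hle.1 fun z hz => ?_)).symm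
    -- Choose `x` with `x + H x = z + H* z`. Then `z - x` is orthogonal to the range of `1 + H`,
    -- which is the whole space, so `z = x` lies in the domain of `H`.
    obtain ⟨x, hx⟩ := hsurj (H.adjoint ⟨z, hz⟩ + z)
    have hadj := H.adjoint_isFormalAdjoint hdense
    have key : z - x = 0 := by
      obtain ⟨y, hy⟩ := hsurj (z - x)
      have h1 := hadj ⟨z, hz⟩ y
      have h2 := hsymm x y
      have h3 : inner ℂ (z - x) (z - (x : 𝓗)) = 0 := by
        have e : z - (x : 𝓗) = H y + y := by rw [hy]; abel
        have e2 : H.adjoint ⟨z, hz⟩ - H x = -(z - x) := by rw [hx]; abel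
        have h4 : inner ℂ (z - (x : 𝓗)) (H y) = inner ℂ (H.adjoint ⟨z, hz⟩ - H x) (y : 𝓗) := by
          rw [inner_sub_left, inner_sub_left, h1, h2]
        conv_lhs => rw [e, inner_add_right, ← e, h4, e2, inner_neg_left]
        ring
      exact inner_self_eq_zero.1 h3
    rw [sub_eq_zero.1 key]
    exact x.2
  · intro x y
    rw [hgraph]
    constructor
    · rintro ⟨hx, hxy⟩
      exact ⟨hx, fun z hz => by rw [hh ⟨z, hz⟩ ⟨x, hx⟩]; exact hxy ⟨z, hz⟩⟩
    · rintro ⟨hx, hxy⟩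
      exact ⟨hx, fun z => by rw [← hh z ⟨x, hx⟩]; exact hxy z z.2⟩

end ClosedOperator

/-! ### Boundary values of test functions, Green's formulas and trace functionals on one beam. -/

lemma MemH.of_zero (n : ℕ) : MemH n (0 : L2I ℓ) := fun _ _ =>
  ⟨0, isWeakDeriv_iff.2 (by simp)⟩

lemma weakDeriv_of_zero (n : ℕ) : weakDeriv n (0 : L2I ℓ) = 0 := by
  simpa using (MemH.of_zero (ℓ := ℓ) n).weakDeriv_smul 0

lemma endValue_of_zero (hℓ : 0 < ℓ) (n : ℕ) {x : ℝ} (hx : x ∈ Set.Icc 0 ℓ) :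
    endValue n (0 : L2I ℓ) x = 0 := by
  simpa using (MemH.of_zero (ℓ := ℓ) (n + 1)).endValue_smul hℓ 0 hx

namespace IsTest

variable {φ : ℝ → ℝ}

lemma isWeakDeriv_toL2 (hℓ : 0 ≤ ℓ) (h : IsTest ℓ φ) (n : ℕ) :
    IsWeakDeriv ℓ n (h.toL2 0) (h.toL2 n) := by
  induction n with
  | zero => exact IsWeakDeriv.refl _
  | succ n ih =>
    refine ih.comp ?_
    have h1 := (h.iteratedDeriv n).toL2_zero_eq_prim.1
    rw [h.toL2_iteratedDeriv, h.toL2_iteratedDeriv, zero_add, add_comm] at h1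
    rw [h1]
    exact isWeakDeriv_prim hℓ _ _

lemma endValue_toL2 (hℓ : 0 < ℓ) (h : IsTest ℓ φ) (n : ℕ) {x : ℝ} (hx : x = 0 ∨ x = ℓ) :
    endValue n (h.toL2 0) x = 0 := by
  have hx' : x ∈ Set.Icc 0 ℓ := by
    rcases hx with rfl | rfl
    · exact ⟨le_rfl, hℓ.le⟩
    · exact ⟨hℓ.le, le_rfl⟩
  have h1 := (h.iteratedDeriv n).toL2_zero_eq_prim
  rw [endValue, (h.isWeakDeriv_toL2 hℓ.le n).weakDeriv_eq, ← zero_add n, ← h.toL2_iteratedDeriv,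
    h1.1, contRep_prim hℓ _ _ hx', h1.2 x hx', (h.iteratedDeriv n).eq_zero, Complex.ofReal_zero]
  rcases hx with rfl | rfl <;> simp

end IsTest

/-- Green's formula of second order. -/
lemma inner_weakDeriv_one (hℓ : 0 < ℓ) {f g : L2I ℓ} (hf : MemH 1 f) (hg : MemH 2 g) :
    inner ℂ (weakDeriv 1 f) (weakDeriv 1 g) = -inner ℂ f (weakDeriv 2 g) +
      (starRingEnd ℂ) (endValue 0 f ℓ) * endValue 1 g ℓ -
        (starRingEnd ℂ) (endValue 0 f 0) * endValue 1 g 0 := by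
  have h1 := MemH.inner_weakDeriv_succ (n := 0) (m := 1) hℓ hf hg
  simp only [zero_add, Nat.reduceAdd, weakDeriv_zero] at h1
  linear_combination h1

/-- Green's formula of fourth order. -/
lemma inner_weakDeriv_two (hℓ : 0 < ℓ) {f g : L2I ℓ} (hf : MemH 2 f) (hg : MemH 4 g) :
    inner ℂ (weakDeriv 2 f) (weakDeriv 2 g) = inner ℂ f (weakDeriv 4 g) +
      ((starRingEnd ℂ) (endValue 1 f ℓ) * endValue 2 g ℓ -
        (starRingEnd ℂ) (endValue 0 f ℓ) * endValue 3 g ℓ) -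
      ((starRingEnd ℂ) (endValue 1 f 0) * endValue 2 g 0 -
        (starRingEnd ℂ) (endValue 0 f 0) * endValue 3 g 0) := by
  have h1 := MemH.inner_weakDeriv_succ (n := 1) (m := 2) hℓ hf (hg.mono (by norm_num))
  have h2 := MemH.inner_weakDeriv_succ (n := 0) (m := 3) hℓ (hf.mono (by norm_num)) hg
  simp only [zero_add, Nat.reduceAdd, weakDeriv_zero] at h1 h2
  linear_combination h1 - h2

/-- On `H¹(0, ℓ)` boundary values are bounded functionals of `(f, f')`. -/
lemma exists_endValue_eq_one (hℓ : 0 < ℓ) {x : ℝ} (hx : x = 0 ∨ x = ℓ) :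
    ∃ p r : L2I ℓ, ∀ f, MemH 1 f →
      endValue 0 f x = inner ℂ p f + inner ℂ r (weakDeriv 1 f) := by
  have key : ∀ f g : L2I ℓ, MemH 1 f → MemH 1 g → _ := fun f g hf hg =>
    MemH.inner_weakDeriv_succ (n := 0) (m := 0) hℓ hf hg
  simp only [zero_add, weakDeriv_zero] at key
  rcases hx with rfl | rfl
  -- The value is `-1` because the boundary term at `0` enters integration by parts with a minus
  -- sign; vanishing at `ℓ` removes the other term.
  · obtain ⟨P, hP, h1, -, h3, -⟩ := exists_memH_endValue hℓ (-1) 0 0 0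
    refine ⟨weakDeriv 1 P, P, fun f hf => ?_⟩
    rw [key P f (hP 1) hf, h1, h3]
    simp
  · obtain ⟨P, hP, h1, -, h3, -⟩ := exists_memH_endValue hℓ 0 0 1 0
    refine ⟨weakDeriv 1 P, P, fun f hf => ?_⟩
    rw [key P f (hP 1) hf, h1, h3]
    simp

/-- On `H²(0, ℓ)` boundary values of `f` and `f'` are bounded functionals of `(f, f'')`. -/
lemma exists_endValue_eq_two (hℓ : 0 < ℓ) {n : ℕ} (hn : n < 2) {x : ℝ} (hx : x = 0 ∨ x = ℓ) :
    ∃ p r : L2I ℓ, ∀ f, MemH 2 f →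
      endValue n f x = inner ℂ p f + inner ℂ r (weakDeriv 2 f) := by
  have key : ∀ P f : L2I ℓ, (∀ n, MemH n P) → MemH 2 f →
      inner ℂ (weakDeriv 2 P) f + inner ℂ (-P) (weakDeriv 2 f) =
        ((starRingEnd ℂ) (endValue 1 P ℓ) * endValue 0 f ℓ -
          (starRingEnd ℂ) (endValue 1 P 0) * endValue 0 f 0) -
        ((starRingEnd ℂ) (endValue 0 P ℓ) * endValue 1 f ℓ -
          (starRingEnd ℂ) (endValue 0 P 0) * endValue 1 f 0) := by
    intro P f hP hf
    have h1 := MemH.inner_weakDeriv_succ (n := 1) (m := 0) hℓ (hP 2) (hf.mono (by norm_num))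
    have h2 := MemH.inner_weakDeriv_succ (n := 0) (m := 1) hℓ (hP 1) hf
    simp only [zero_add, Nat.reduceAdd, weakDeriv_zero] at h1 h2
    rw [inner_neg_left]
    linear_combination h1 - h2
  -- The four boundary data of the auxiliary function `P` weight the four boundary values of `f`;
  -- one nonzero datum isolates one value.
  have main : ∀ α β γ δ : ℂ, ∃ p r : L2I ℓ, ∀ f, MemH 2 f →
      inner ℂ p f + inner ℂ r (weakDeriv 2 f) =
        ((starRingEnd ℂ) δ * endValue 0 f ℓ - (starRingEnd ℂ) β * endValue 0 f 0) -
        ((starRingEnd ℂ) γ * endValue 1 f ℓ - (starRingEnd ℂ) α * endValue 1 f 0) := by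
    intro α β γ δ
    obtain ⟨P, hP, h1, h2, h3, h4⟩ := exists_memH_endValue hℓ α β γ δ
    exact ⟨weakDeriv 2 P, -P, fun f hf => by rw [key P f hP hf, h1, h2, h3, h4]⟩
  interval_cases n <;> rcases hx with rfl | rfl
  · obtain ⟨p, r, h⟩ := main 0 (-1) 0 0
    exact ⟨p, r, fun f hf => by rw [h f hf]; simp⟩
  · obtain ⟨p, r, h⟩ := main 0 0 0 1
    exact ⟨p, r, fun f hf => by rw [h f hf]; simp⟩
  · obtain ⟨p, r, h⟩ := main 1 0 0 0
    exact ⟨p, r, fun f hf => by rw [h f hf]; simp⟩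
  · obtain ⟨p, r, h⟩ := main 0 0 (-1) 0
    exact ⟨p, r, fun f hf => by rw [h f hf]; simp⟩

/-- Half the order of the differential operator that acts on the given field. -/
def DOF.order : DOF → ℕ
  | .v => 2
  | .w => 2
  | .u => 1
  | .η => 1

lemma DOF.order_pos (q : DOF) : 0 < q.order := by cases q <;> simp [DOF.order]

namespace BeamFrame

open Matrix

variable {V E : Type*} {F : BeamFrame V E}

/-! ### Geometry of the frame -/

/-- A loop would force `i = 0`. This matters because `sign` and `coord` give the origin precedence
and would lose the terminus of a loop. -/
lemma org_ne_ter (e : E) : F.org e ≠ F.ter e := by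
  intro h
  have h1 := F.axis e
  rw [h, sub_self] at h1
  have h2 : F.i e = 0 := (smul_eq_zero.1 h1.symm).resolve_left (F.length_pos e).ne'
  have h3 := (F.orthonormal e).1 0
  simp [h2] at h3

lemma coord_eq (e : E) (𝔳 : V) : F.coord e 𝔳 = 0 ∨ F.coord e 𝔳 = F.length e := by
  unfold coord
  split_ifs <;> simp

lemma coord_mem (e : E) (𝔳 : V) : F.coord e 𝔳 ∈ Set.Icc 0 (F.length e) := by
  rcases F.coord_eq e 𝔳 with h | h <;> rw [h]
  · exact ⟨le_rfl, (F.length_pos e).le⟩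
  · exact ⟨(F.length_pos e).le, le_rfl⟩

lemma coord_org (e : E) : F.coord e (F.org e) = 0 := by simp [coord]

lemma coord_ter (e : E) : F.coord e (F.ter e) = F.length e := by
  simp [coord, F.org_ne_ter e]

lemma toC3_dotProduct (x y : EuclideanSpace ℝ (Fin 3)) :
    toC3 x ⬝ᵥ toC3 y = ((inner ℝ x y : ℝ) : ℂ) := by
  simp [dotProduct, toC3, PiLp.inner_apply, mul_comm]

lemma star_toC3 (x : EuclideanSpace ℝ (Fin 3)) : star (toC3 x) = toC3 x := by
  ext m
  simp [toC3]

lemma basis_dotProduct (F : BeamFrame V E) (e : E) :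
    toC3 (F.i e) ⬝ᵥ toC3 (F.i e) = 1 ∧ toC3 (F.j e) ⬝ᵥ toC3 (F.j e) = 1 ∧
    toC3 (F.k e) ⬝ᵥ toC3 (F.k e) = 1 ∧ toC3 (F.i e) ⬝ᵥ toC3 (F.j e) = 0 ∧
    toC3 (F.i e) ⬝ᵥ toC3 (F.k e) = 0 ∧ toC3 (F.j e) ⬝ᵥ toC3 (F.k e) = 0 := by
  have h := orthonormal_iff_ite.1 (F.orthonormal e)
  have h00 := h 0 0
  have h11 := h 1 1
  have h22 := h 2 2
  have h01 := h 0 1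
  have h02 := h 0 2
  have h12 := h 1 2
  simp only [cons_val_zero, cons_val_one, cons_val, if_true, Fin.isValue] at h00 h11 h22 h01 h02 h12
  simp only [toC3_dotProduct]
  rw [h00, h11, h22, h01, h02, h12]
  simp

lemma star_combination_dotProduct (F : BeamFrame V E) (e : E) (x y z x' y' z' : ℂ) :
    star (x • toC3 (F.i e) + y • toC3 (F.j e) + z • toC3 (F.k e)) ⬝ᵥ
      (x' • toC3 (F.i e) + y' • toC3 (F.j e) + z' • toC3 (F.k e)) =
    (starRingEnd ℂ) x * x' + (starRingEnd ℂ) y * y' + (starRingEnd ℂ) z * z' := by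
  obtain ⟨h1, h2, h3, h4, h5, h6⟩ := F.basis_dotProduct e
  have h4' := (dotProduct_comm _ _).trans h4
  have h5' := (dotProduct_comm _ _).trans h5
  have h6' := (dotProduct_comm _ _).trans h6
  simp only [star_add, star_smul, star_toC3, add_dotProduct, dotProduct_add, smul_dotProduct,
    dotProduct_smul, h1, h2, h3, h4, h5, h6, h4', h5', h6', smul_eq_mul]
  simp only [RCLike.star_def]
  ring

/-- The matrix `M` with the basis as rows satisfies `M Mᵀ = 1`, hence `Mᵀ M = 1`, and the
coefficients are `M X`. The transpose suffices since the entries are real. -/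
lemma exists_eq_combination (F : BeamFrame V E) (e : E) (X : Fin 3 → ℂ) :
    ∃ x y z : ℂ, X = x • toC3 (F.i e) + y • toC3 (F.j e) + z • toC3 (F.k e) := by
  obtain ⟨h1, h2, h3, h4, h5, h6⟩ := F.basis_dotProduct e
  have h4' := (dotProduct_comm _ _).trans h4
  have h5' := (dotProduct_comm _ _).trans h5
  have h6' := (dotProduct_comm _ _).trans h6
  let M : Matrix (Fin 3) (Fin 3) ℂ := Matrix.of ![toC3 (F.i e), toC3 (F.j e), toC3 (F.k e)]
  have hM : M * Mᵀ = 1 := by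
    ext a b
    have : (M * Mᵀ) a b = ![toC3 (F.i e), toC3 (F.j e), toC3 (F.k e)] a ⬝ᵥ
      ![toC3 (F.i e), toC3 (F.j e), toC3 (F.k e)] b := rfl
    rw [this]
    fin_cases a <;> fin_cases b <;> simp [h1, h2, h3, h4, h5, h6, h4', h5', h6']
  have hM' : Mᵀ * M = 1 := mul_eq_one_comm.1 hM
  refine ⟨(M *ᵥ X) 0, (M *ᵥ X) 1, (M *ᵥ X) 2, ?_⟩
  have : Mᵀ *ᵥ (M *ᵥ X) = X := by rw [mulVec_mulVec, hM', one_mulVec]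
  conv_lhs => rw [← this]
  rw [mulVec_transpose]
  ext m
  simp [vecMul, dotProduct, Fin.sum_univ_three, M]

open Classical in
-- Regroups the contributions of the beam ends by joint. Only endpoints of edges are summed over, as
-- `V` may be infinite.
lemma sum_org_sub_ter [Fintype E] (f : E → V → ℂ) :
    ∑ e, (f e (F.org e) - f e (F.ter e)) =
      ∑ 𝔳 ∈ Finset.univ.image F.org ∪ Finset.univ.image F.ter,
        ∑ e : E with F.Incident e 𝔳, F.sign e 𝔳 * f e 𝔳 := by
  rw [Finset.sum_comm' (t' := Finset.univ) (s' := fun e => {F.org e, F.ter e})]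
  · refine Finset.sum_congr rfl fun e _ => ?_
    rw [Finset.sum_pair (F.org_ne_ter e)]
    simp [sign, F.org_ne_ter e]
    ring
  · intro 𝔳 e
    simp only [Finset.mem_union, Finset.mem_image, Finset.mem_univ, true_and, Finset.mem_filter,
      Finset.mem_insert, Finset.mem_singleton, and_true]
    unfold Incident
    constructor
    · rintro ⟨-, h | h⟩
      · exact Or.inl h.symm
      · exact Or.inr h.symm
    · rintro (rfl | rfl)
      · exact ⟨Or.inl ⟨e, rfl⟩, Or.inl rfl⟩
      · exact ⟨Or.inr ⟨e, rfl⟩, Or.inr rfl⟩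

/-! ### The form domain -/

/-- The stiffness constant that belongs to a field on an edge. -/
def stiffness (F : BeamFrame V E) : E × DOF → ℝ
  | (e, .v) => F.a e
  | (e, .w) => F.b e
  | (e, .u) => F.c e
  | (e, .η) => F.d e

lemma stiffness_pos (p : E × DOF) : 0 < F.stiffness p := by
  obtain ⟨e, _ | _ | _ | _⟩ := p
  exacts [F.a_pos e, F.b_pos e, F.c_pos e, F.d_pos e]

lemma forall_edge_dof {P : E × DOF → Prop} :
    (∀ p, P p) ↔ ∀ e, P (e, .v) ∧ P (e, .w) ∧ P (e, .u) ∧ P (e, .η) := by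
  constructor
  · exact fun h e => ⟨h _, h _, h _, h _⟩
  · rintro h ⟨e, _ | _ | _ | _⟩
    exacts [(h e).1, (h e).2.1, (h e).2.2.1, (h e).2.2.2]

/-- The fields of a configuration have the Sobolev regularity of the form domain. -/
def Regular (Ψ : F.L2) : Prop := ∀ p, MemH p.2.order (Ψ p)

lemma mem_formDomain {Ψ : F.L2} : Ψ ∈ F.formDomain ↔
    Regular Ψ ∧ ∀ 𝔳, DisplacementContinuous Ψ 𝔳 ∧ RotationContinuous Ψ 𝔳 :=
  and_congr_left' (forall_edge_dof (P := fun p => MemH p.2.order (Ψ p))).symm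

lemma vert_add {Φ Ψ : F.L2} (hΦ : Regular Φ) (hΨ : Regular Ψ) {q : DOF} {n : ℕ}
    (hn : n < q.order) (e : E) (𝔳 : V) : vert (Φ + Ψ) q n e 𝔳 = vert Φ q n e 𝔳 + vert Ψ q n e 𝔳 :=
  ((hΦ (e, q)).mono hn).endValue_add (F.length_pos e) ((hΨ (e, q)).mono hn) (F.coord_mem e 𝔳)

lemma vert_smul {Ψ : F.L2} (hΨ : Regular Ψ) (r : ℂ) {q : DOF} {n : ℕ}
    (hn : n < q.order) (e : E) (𝔳 : V) : vert (r • Ψ) q n e 𝔳 = r * vert Ψ q n e 𝔳 :=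
  ((hΨ (e, q)).mono hn).endValue_smul (F.length_pos e) r (F.coord_mem e 𝔳)

lemma displacement_add {Φ Ψ : F.L2} (hΦ : Regular Φ) (hΨ : Regular Ψ) (e : E) (𝔳 : V) :
    displacement (Φ + Ψ) e 𝔳 = displacement Φ e 𝔳 + displacement Ψ e 𝔳 := by
  simp only [displacement, vert_add hΦ hΨ (DOF.order_pos _), add_smul]
  abel

lemma rotation_add {Φ Ψ : F.L2} (hΦ : Regular Φ) (hΨ : Regular Ψ) (e : E) (𝔳 : V) :
    rotation (Φ + Ψ) e 𝔳 = rotation Φ e 𝔳 + rotation Ψ e 𝔳 := by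
  simp only [rotation, vert_add hΦ hΨ (q := .η) Nat.one_pos,
    vert_add hΦ hΨ (q := .v) Nat.one_lt_two, vert_add hΦ hΨ (q := .w) Nat.one_lt_two, add_smul]
  abel

lemma displacement_smul {Ψ : F.L2} (hΨ : Regular Ψ) (r : ℂ) (e : E) (𝔳 : V) :
    displacement (r • Ψ) e 𝔳 = r • displacement Ψ e 𝔳 := by
  simp only [displacement, vert_smul hΨ r (DOF.order_pos _), mul_smul, smul_add]

lemma rotation_smul {Ψ : F.L2} (hΨ : Regular Ψ) (r : ℂ) (e : E) (𝔳 : V) :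
    rotation (r • Ψ) e 𝔳 = r • rotation Ψ e 𝔳 := by
  simp only [rotation, vert_smul hΨ r (q := .η) Nat.one_pos,
    vert_smul hΨ r (q := .v) Nat.one_lt_two, vert_smul hΨ r (q := .w) Nat.one_lt_two, mul_smul,
    smul_add, smul_sub]

lemma mem_formDomain_of_vert_eq_zero {Ψ : F.L2} (hΨ : Regular Ψ)
    (h : ∀ q n e 𝔳, n < q.order → vert Ψ q n e 𝔳 = 0) : Ψ ∈ F.formDomain := by
  refine mem_formDomain.2 ⟨hΨ, fun 𝔳 => ⟨fun e e' _ _ => ?_, fun e e' _ _ => ?_⟩⟩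
  · simp only [displacement, h _ 0 _ _ (DOF.order_pos _)]
    simp
  · simp only [rotation, h .η 0 _ _ Nat.one_pos, h .v 1 _ _ Nat.one_lt_two,
      h .w 1 _ _ Nat.one_lt_two]
    simp

lemma exists_vert_eq (F : BeamFrame V E) {q : DOF} {n : ℕ} (hn : n < q.order) (e : E) (𝔳 : V) :
    ∃ x y : L2I (F.length e), ∀ Ψ : F.L2, Regular Ψ →
      vert Ψ q n e 𝔳 = inner ℂ x (Ψ (e, q)) + inner ℂ y (weakDeriv q.order (Ψ (e, q))) := by
  have key : ∃ x y : L2I (F.length e), ∀ f : L2I (F.length e), MemH q.order f →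
      endValue n f (F.coord e 𝔳) = inner ℂ x f + inner ℂ y (weakDeriv q.order f) := by
    cases q
    · exact exists_endValue_eq_two (F.length_pos e) hn (F.coord_eq e 𝔳)
    · exact exists_endValue_eq_two (F.length_pos e) hn (F.coord_eq e 𝔳)
    · obtain rfl : n = 0 := by simpa [DOF.order] using hn
      exact exists_endValue_eq_one (F.length_pos e) (F.coord_eq e 𝔳)
    · obtain rfl : n = 0 := by simpa [DOF.order] using hn
      exact exists_endValue_eq_one (F.length_pos e) (F.coord_eq e 𝔳)
  obtain ⟨x, y, h⟩ := key
  exact ⟨x, y, fun Ψ hΨ => h _ (hΨ (e, q))⟩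

open Classical in
/-- A configuration in which a single field on a single edge is a test function. -/
def testField (F : BeamFrame V E) (p : E × DOF) {φ : ℝ → ℝ} (hφ : IsTest (F.length p.1) φ) :
    F.L2 :=
  PiLp.single 2 p (hφ.toL2 0)

lemma testField_same (p : E × DOF) {φ : ℝ → ℝ} (hφ : IsTest (F.length p.1) φ) :
    F.testField p hφ p = hφ.toL2 0 := by
  classical
  exact PiLp.single_eq_same _ _ _

lemma testField_ne {p p' : E × DOF} (h : p' ≠ p) {φ : ℝ → ℝ} (hφ : IsTest (F.length p.1) φ) :
    F.testField p hφ p' = 0 := by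
  classical
  exact PiLp.single_eq_of_ne _ h _

lemma testField_mem_formDomain (p : E × DOF) {φ : ℝ → ℝ} (hφ : IsTest (F.length p.1) φ) :
    F.testField p hφ ∈ F.formDomain := by
  refine mem_formDomain_of_vert_eq_zero (fun p' => ?_) fun q n e 𝔳 _ => ?_
  · by_cases h : p' = p
    · subst h
      rw [testField_same]
      exact (hφ.isWeakDeriv_toL2 (F.length_pos _).le _).memH (F.length_pos _)
    · rw [testField_ne h]
      exact MemH.of_zero _
  · rw [vert]
    by_cases h : (e, q) = p
    · subst h
      rw [testField_same]
      exact hφ.endValue_toL2 (F.length_pos e) n (F.coord_eq e 𝔳)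
    · rw [testField_ne h]
      exact endValue_of_zero (F.length_pos e) n (F.coord_mem e 𝔳)

/-- The form domain as a linear subspace. -/
def formSubmodule (F : BeamFrame V E) : Submodule ℂ F.L2 where
  carrier := F.formDomain
  zero_mem' := mem_formDomain_of_vert_eq_zero (fun _ => MemH.of_zero _) fun _ n e 𝔳 _ =>
    endValue_of_zero (F.length_pos e) n (F.coord_mem e 𝔳)
  add_mem' := by
    intro Φ Ψ hΦ hΨ
    rw [mem_formDomain] at hΦ hΨ ⊢
    refine ⟨fun p => (hΦ.1 p).add (hΨ.1 p), fun 𝔳 => ⟨fun e e' he he' => ?_, fun e e' he he' => ?_⟩⟩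
    · rw [displacement_add hΦ.1 hΨ.1, displacement_add hΦ.1 hΨ.1, (hΦ.2 𝔳).1 e e' he he',
        (hΨ.2 𝔳).1 e e' he he']
    · rw [rotation_add hΦ.1 hΨ.1, rotation_add hΦ.1 hΨ.1, (hΦ.2 𝔳).2 e e' he he',
        (hΨ.2 𝔳).2 e e' he he']
  smul_mem' := by
    intro r Ψ hΨ
    rw [mem_formDomain] at hΨ ⊢
    refine ⟨fun p => (hΨ.1 p).smul r, fun 𝔳 => ⟨fun e e' he he' => ?_, fun e e' he he' => ?_⟩⟩
    · rw [displacement_smul hΨ.1, displacement_smul hΨ.1, (hΨ.2 𝔳).1 e e' he he']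
    · rw [rotation_smul hΨ.1, rotation_smul hΨ.1, (hΨ.2 𝔳).2 e e' he he']

lemma regular_of_mem (Ψ : F.formSubmodule) : Regular (Ψ : F.L2) := (mem_formDomain.1 Ψ.2).1

/-- The strain operator, whose modulus squared is the energy form. -/
def strain (F : BeamFrame V E) : F.L2 →ₗ.[ℂ] F.L2 where
  domain := F.formSubmodule
  toFun :=
    { toFun := fun Ψ => WithLp.toLp 2 fun p =>
        ((√(F.stiffness p) : ℝ) : ℂ) • weakDeriv p.2.order ((Ψ : F.L2) p)
      map_add' := fun Φ Ψ => PiLp.ext fun p => by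
        change _ • weakDeriv _ ((Φ : F.L2) p + (Ψ : F.L2) p) = _
        rw [(regular_of_mem Φ p).weakDeriv_add (regular_of_mem Ψ p), smul_add]
        rfl
      map_smul' := fun r Ψ => PiLp.ext fun p => by
        change _ • weakDeriv _ (r • (Ψ : F.L2) p) = _
        rw [(regular_of_mem Ψ p).weakDeriv_smul, smul_comm]
        rfl }

lemma strain_apply (Ψ : F.strain.domain) (p : E × DOF) :
    F.strain Ψ p = ((√(F.stiffness p) : ℝ) : ℂ) • weakDeriv p.2.order ((Ψ : F.L2) p) := rfl

/-! ### Generalized forces and the differential expression -/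

/-- The work done by the generalized forces of `Ψ` on the displacements and rotations of `Φ`. -/
def work (Φ Ψ : F.L2) (e : E) (𝔳 : V) : ℂ :=
  star (displacement Φ e 𝔳) ⬝ᵥ force Ψ e 𝔳 + star (rotation Φ e 𝔳) ⬝ᵥ moment Ψ e 𝔳

/-- By orthonormality of the local basis, the two vector pairings reduce to exactly the boundary
terms of the scalar Green's formulas. This is why force and moment have their particular signs. -/
lemma work_eq (Φ Ψ : F.L2) (e : E) (𝔳 : V) : work Φ Ψ e 𝔳 =
    F.a e * ((starRingEnd ℂ) (vert Φ .v 1 e 𝔳) * vert Ψ .v 2 e 𝔳 -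
      (starRingEnd ℂ) (vert Φ .v 0 e 𝔳) * vert Ψ .v 3 e 𝔳) +
    F.b e * ((starRingEnd ℂ) (vert Φ .w 1 e 𝔳) * vert Ψ .w 2 e 𝔳 -
      (starRingEnd ℂ) (vert Φ .w 0 e 𝔳) * vert Ψ .w 3 e 𝔳) +
    F.c e * ((starRingEnd ℂ) (vert Φ .u 0 e 𝔳) * vert Ψ .u 1 e 𝔳) +
    F.d e * ((starRingEnd ℂ) (vert Φ .η 0 e 𝔳) * vert Ψ .η 1 e 𝔳) := by
  have h1 : force Ψ e 𝔳 = ((F.c e : ℂ) * vert Ψ .u 1 e 𝔳) • toC3 (F.i e) +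
      (-((F.b e : ℂ) * vert Ψ .w 3 e 𝔳)) • toC3 (F.j e) +
      (-((F.a e : ℂ) * vert Ψ .v 3 e 𝔳)) • toC3 (F.k e) := by
    rw [force, neg_smul, neg_smul]; abel
  have h2 : rotation Φ e 𝔳 = vert Φ .η 0 e 𝔳 • toC3 (F.i e) +
      (-vert Φ .v 1 e 𝔳) • toC3 (F.j e) + vert Φ .w 1 e 𝔳 • toC3 (F.k e) := by
    rw [rotation, neg_smul]; abel
  have h3 : moment Ψ e 𝔳 = ((F.d e : ℂ) * vert Ψ .η 1 e 𝔳) • toC3 (F.i e) +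
      (-((F.a e : ℂ) * vert Ψ .v 2 e 𝔳)) • toC3 (F.j e) +
      ((F.b e : ℂ) * vert Ψ .w 2 e 𝔳) • toC3 (F.k e) := by
    rw [moment, neg_smul]; abel
  rw [work, h1, h2, h3, displacement, star_combination_dotProduct, star_combination_dotProduct]
  simp only [map_neg]
  ring

/-- The differential expression `(a v'''', b w'''', -c u'', -d η'')`. -/
def diffExpr (Ψ : F.L2) : F.L2 := WithLp.toLp 2 fun p =>
  ((-1 : ℂ) ^ p.2.order * F.stiffness p) • weakDeriv (2 * p.2.order) (Ψ p)

lemma diffExpr_apply (Ψ : F.L2) (p : E × DOF) : diffExpr Ψ p =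
    ((-1 : ℂ) ^ p.2.order * F.stiffness p) • weakDeriv (2 * p.2.order) (Ψ p) := rfl

lemma regular_of_memH_two_mul {Ψ : F.L2} (hΨ : ∀ p, MemH (2 * p.2.order) (Ψ p)) : Regular Ψ :=
  fun p => (hΨ p).mono (by omega)

/-- Displacements and rotations of the joints can be prescribed arbitrarily. -/
lemma exists_displacement_rotation (F : BeamFrame V E) (X Y : V → Fin 3 → ℂ) :
    ∃ Φ ∈ F.formDomain, ∀ e 𝔳, F.Incident e 𝔳 →
      displacement Φ e 𝔳 = X 𝔳 ∧ rotation Φ e 𝔳 = Y 𝔳 := by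
  choose xi xj xk hX using fun e 𝔳 => F.exists_eq_combination e (X 𝔳)
  choose yi yj yk hY using fun e 𝔳 => F.exists_eq_combination e (Y 𝔳)
  have key : ∀ e (α β γ δ : ℂ), ∃ f : L2I (F.length e), (∀ n, MemH n f) ∧
    endValue 0 f 0 = α ∧ endValue 1 f 0 = β ∧ endValue 0 f (F.length e) = γ ∧
      endValue 1 f (F.length e) = δ := fun e => exists_memH_endValue (F.length_pos e)
  choose f hf h0 h1 h2 h3 using key
  let val : DOF → E → V → ℂ
    | .v => xk
    | .w => xj
    | .u => xi
    | .η => yi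
  -- The minus sign matches the term `-v' j` of the rotation. The end slopes of `u` and `η` enter no
  -- joint condition and are set to zero.
  let der : DOF → E → V → ℂ
    | .v => fun e 𝔳 => -yj e 𝔳
    | .w => yk
    | .u => 0
    | .η => 0
  let Φ : F.L2 := WithLp.toLp 2 fun p =>
    f p.1 (val p.2 p.1 (F.org p.1)) (der p.2 p.1 (F.org p.1))
      (val p.2 p.1 (F.ter p.1)) (der p.2 p.1 (F.ter p.1))
  have hval : ∀ q e 𝔳, F.Incident e 𝔳 → vert Φ q 0 e 𝔳 = val q e 𝔳 := by
    rintro q e 𝔳 (rfl | rfl)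
    · rw [vert, coord_org]; exact h0 _ _ _ _ _
    · rw [vert, coord_ter]; exact h2 _ _ _ _ _
  have hder : ∀ q e 𝔳, F.Incident e 𝔳 → vert Φ q 1 e 𝔳 = der q e 𝔳 := by
    rintro q e 𝔳 (rfl | rfl)
    · rw [vert, coord_org]; exact h1 _ _ _ _ _
    · rw [vert, coord_ter]; exact h3 _ _ _ _ _
  have hΦ : ∀ e 𝔳, F.Incident e 𝔳 → displacement Φ e 𝔳 = X 𝔳 ∧ rotation Φ e 𝔳 = Y 𝔳 := by
    intro e 𝔳 he
    constructor
    · rw [displacement, hval _ _ _ he, hval _ _ _ he, hval _ _ _ he]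
      exact (hX e 𝔳).symm
    · rw [rotation, hval _ _ _ he, hder _ _ _ he, hder _ _ _ he]
      conv_rhs => rw [hY e 𝔳]
      simp [val, der]
  refine ⟨Φ, mem_formDomain.2 ⟨fun p => hf _ _ _ _ _ _, fun 𝔳 => ⟨fun e e' he he' => ?_,
    fun e e' he he' => ?_⟩⟩, hΦ⟩
  · rw [(hΦ e 𝔳 he).1, (hΦ e' 𝔳 he').1]
  · rw [(hΦ e 𝔳 he).2, (hΦ e' 𝔳 he').2]

/-! ### The energy form -/

variable [Fintype E]

lemma mem_operatorDomain {Ψ : F.L2} : Ψ ∈ F.operatorDomain ↔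
    (∀ p, MemH (2 * p.2.order) (Ψ p)) ∧ ∀ 𝔳, DisplacementContinuous Ψ 𝔳 ∧
      RotationContinuous Ψ 𝔳 ∧ ForceBalance Ψ 𝔳 ∧ MomentBalance Ψ 𝔳 :=
  and_congr_left' (forall_edge_dof (P := fun p => MemH (2 * p.2.order) (Ψ p))).symm

lemma sum_edge_dof (f : E × DOF → ℂ) :
    ∑ p, f p = ∑ e, (f (e, .v) + f (e, .w) + f (e, .u) + f (e, .η)) := by
  rw [Fintype.sum_prod_type]
  refine Finset.sum_congr rfl fun e _ => ?_
  have : (Finset.univ : Finset DOF) = {DOF.v, DOF.w, DOF.u, DOF.η} := rfl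
  rw [this]
  simp [add_assoc]

lemma energyForm_eq_sum (Φ Ψ : F.L2) : F.energyForm Φ Ψ =
    ∑ p : E × DOF, (F.stiffness p : ℂ) *
      inner ℂ (weakDeriv p.2.order (Φ p)) (weakDeriv p.2.order (Ψ p)) := by
  rw [sum_edge_dof]
  rfl

lemma inner_testField (p : E × DOF) {φ : ℝ → ℝ} (hφ : IsTest (F.length p.1) φ) (Ψ : F.L2) :
    inner ℂ (F.testField p hφ) Ψ = inner ℂ (hφ.toL2 0) (Ψ p) := by
  rw [PiLp.inner_apply, Finset.sum_eq_single p]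
  · rw [testField_same]
  · intro p' _ h
    rw [testField_ne h, inner_zero_left]
  · simp

lemma energyForm_testField (p : E × DOF) {φ : ℝ → ℝ} (hφ : IsTest (F.length p.1) φ) (Ψ : F.L2) :
    F.energyForm (F.testField p hφ) Ψ =
      F.stiffness p * inner ℂ (hφ.toL2 p.2.order) (weakDeriv p.2.order (Ψ p)) := by
  rw [energyForm_eq_sum, Finset.sum_eq_single p]
  · rw [testField_same, (hφ.isWeakDeriv_toL2 (F.length_pos _).le _).weakDeriv_eq]
  · intro p' _ h
    rw [testField_ne h, weakDeriv_of_zero, inner_zero_left, mul_zero]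
  · simp

/-- Test functions on single fields belong to the form domain, and a configuration orthogonal to all
of them is zero. -/
lemma dense_formDomain (F : BeamFrame V E) : Dense (F.formSubmodule : Set F.L2) := by
  rw [Submodule.dense_iff_topologicalClosure_eq_top, Submodule.topologicalClosure_eq_top_iff,
    Submodule.eq_bot_iff]
  intro Ψ hΨ
  refine PiLp.ext fun p => eq_zero_of_inner_toL2_eq_zero fun φ hφ => ?_
  rw [← inner_testField]
  exact (Submodule.mem_orthogonal _ _).1 hΨ _ (F.testField_mem_formDomain p hφ)

lemma energyForm_eq_inner_strain (Φ Ψ : F.strain.domain) :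
    F.energyForm Φ Ψ = inner ℂ (F.strain Φ) (F.strain Ψ) := by
  rw [energyForm_eq_sum, PiLp.inner_apply]
  refine Finset.sum_congr rfl fun p _ => ?_
  rw [strain_apply, strain_apply, inner_smul_left, inner_smul_right, Complex.conj_ofReal,
    ← mul_assoc, ← Complex.ofReal_mul, Real.mul_self_sqrt (F.stiffness_pos p).le]

/-- Convergence in the graph controls each field and its top weak derivative in `L²`. Boundary
values are bounded functionals of this pair (`exists_vert_eq`), so the joint conditions pass to the
limit. -/
lemma isClosed_strain (F : BeamFrame V E) : F.strain.IsClosed := by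
  refine isSeqClosed_iff_isClosed.1 fun x p hx hp => ?_
  obtain ⟨Ψ, Θ⟩ := p
  choose y hy1 hy2 using fun k => F.strain.mem_graph_iff.1 (hx k)
  have hΨ : Tendsto (fun k => (y k : F.L2)) atTop (𝓝 Ψ) :=
    ((continuous_fst.tendsto _).comp hp).congr fun k => (hy1 k).symm
  have hΘ : Tendsto (fun k => F.strain (y k)) atTop (𝓝 Θ) :=
    ((continuous_snd.tendsto _).comp hp).congr fun k => (hy2 k).symm
  have hΨp : ∀ p, Tendsto (fun k => (y k : F.L2) p) atTop (𝓝 (Ψ p)) := fun p =>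
    ((PiLp.continuous_apply 2 _ p).tendsto Ψ).comp hΨ
  have hs : ∀ p, ((√(F.stiffness p) : ℝ) : ℂ) ≠ 0 := fun p => by
    exact_mod_cast (Real.sqrt_pos.2 (F.stiffness_pos p)).ne'
  have hD : ∀ p, Tendsto (fun k => weakDeriv p.2.order ((y k : F.L2) p)) atTop
      (𝓝 (((√(F.stiffness p) : ℝ) : ℂ)⁻¹ • Θ p)) := fun p => by
    refine ((((PiLp.continuous_apply 2 _ p).tendsto Θ).comp hΘ).const_smul
      (((√(F.stiffness p) : ℝ) : ℂ)⁻¹)).congr fun k => ?_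
    rw [Function.comp_apply, strain_apply, inv_smul_smul₀ (hs p)]
  have hwd : ∀ p, IsWeakDeriv (F.length p.1) p.2.order (Ψ p)
      (((√(F.stiffness p) : ℝ) : ℂ)⁻¹ • Θ p) := fun p =>
    IsWeakDeriv.tendsto (fun k => (regular_of_mem (y k) p).isWeakDeriv) (hΨp p) (hD p)
  have hreg : Regular Ψ := fun p => (hwd p).memH (F.length_pos _)
  have hvert : ∀ (q : DOF) (n : ℕ), n < q.order → ∀ (e : E) (𝔳 : V),
      Tendsto (fun k => vert (y k : F.L2) q n e 𝔳) atTop (𝓝 (vert Ψ q n e 𝔳)) := by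
    intro q n hn e 𝔳
    obtain ⟨a, b, h⟩ := F.exists_vert_eq hn e 𝔳
    rw [h Ψ hreg, (hwd (e, q)).weakDeriv_eq]
    refine Tendsto.congr (fun k => (h _ (regular_of_mem (y k))).symm) ?_
    exact (tendsto_const_nhds.inner (hΨp (e, q))).add (tendsto_const_nhds.inner (hD (e, q)))
  have hdisp : ∀ e 𝔳, Tendsto (fun k => displacement (y k : F.L2) e 𝔳) atTop
      (𝓝 (displacement Ψ e 𝔳)) := fun e 𝔳 =>
    (((hvert .u 0 Nat.one_pos e 𝔳).smul_const _).add
      ((hvert .w 0 Nat.two_pos e 𝔳).smul_const _)).add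
      ((hvert .v 0 Nat.two_pos e 𝔳).smul_const _)
  have hrot : ∀ e 𝔳, Tendsto (fun k => rotation (y k : F.L2) e 𝔳) atTop
      (𝓝 (rotation Ψ e 𝔳)) := fun e 𝔳 =>
    (((hvert .η 0 Nat.one_pos e 𝔳).smul_const _).sub
      ((hvert .v 1 Nat.one_lt_two e 𝔳).smul_const _)).add
      ((hvert .w 1 Nat.one_lt_two e 𝔳).smul_const _)
  have hmem : Ψ ∈ F.formDomain := by
    refine mem_formDomain.2 ⟨hreg, fun 𝔳 => ⟨fun e e' he he' => ?_, fun e e' he he' => ?_⟩⟩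
    · refine tendsto_nhds_unique (hdisp e 𝔳) ((hdisp e' 𝔳).congr fun k => ?_)
      exact ((mem_formDomain.1 (y k).2).2 𝔳).1 e' e he' he
    · refine tendsto_nhds_unique (hrot e 𝔳) ((hrot e' 𝔳).congr fun k => ?_)
      exact ((mem_formDomain.1 (y k).2).2 𝔳).2 e' e he' he
  refine F.strain.mem_graph_iff.2 ⟨⟨Ψ, hmem⟩, rfl, PiLp.ext fun p => ?_⟩
  rw [strain_apply, (hwd p).weakDeriv_eq, smul_inv_smul₀ (hs p)]

/-! ### Green's formula on the frame -/

lemma energyForm_eq_inner_sub {Φ Ψ : F.L2} (hΦ : Regular Φ)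
    (hΨ : ∀ p, MemH (2 * p.2.order) (Ψ p)) : F.energyForm Φ Ψ =
      inner ℂ Φ (diffExpr Ψ) - ∑ e, (work Φ Ψ e (F.org e) - work Φ Ψ e (F.ter e)) := by
  rw [PiLp.inner_apply, sum_edge_dof, energyForm, ← Finset.sum_sub_distrib]
  refine Finset.sum_congr rfl fun e _ => ?_
  have hl := F.length_pos e
  have hv := inner_weakDeriv_two hl (hΦ (e, .v)) (hΨ (e, .v))
  have hw := inner_weakDeriv_two hl (hΦ (e, .w)) (hΨ (e, .w))
  have hu := inner_weakDeriv_one hl (hΦ (e, .u)) (hΨ (e, .u))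
  have hη := inner_weakDeriv_one hl (hΦ (e, .η)) (hΨ (e, .η))
  rw [work_eq, work_eq]
  simp only [vert, coord_org, coord_ter, diffExpr_apply, inner_smul_right, stiffness, DOF.order,
    Nat.reduceMul] at hv hw hu hη ⊢
  rw [hv, hw, hu, hη]
  ring

open Classical in
/-- The sum of the works at the vertices, for a configuration with rigid joints. -/
lemma sum_sign_mul_work {Φ : F.L2} (Ψ : F.L2) (𝔳 : V) {X Y : Fin 3 → ℂ}
    (hX : ∀ e, F.Incident e 𝔳 → displacement Φ e 𝔳 = X)
    (hY : ∀ e, F.Incident e 𝔳 → rotation Φ e 𝔳 = Y) :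
    ∑ e : E with F.Incident e 𝔳, F.sign e 𝔳 * work Φ Ψ e 𝔳 =
      star X ⬝ᵥ (∑ e : E with F.Incident e 𝔳, F.sign e 𝔳 • force Ψ e 𝔳) +
      star Y ⬝ᵥ (∑ e : E with F.Incident e 𝔳, F.sign e 𝔳 • moment Ψ e 𝔳) := by
  rw [dotProduct_sum, dotProduct_sum, ← Finset.sum_add_distrib]
  refine Finset.sum_congr rfl fun e he => ?_
  have he' : F.Incident e 𝔳 := (Finset.mem_filter.1 he).2
  rw [work, hX e he', hY e he', dotProduct_smul, dotProduct_smul, smul_eq_mul, smul_eq_mul, mul_add]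

/-- At each joint the common displacement and rotation of `Φ` factor out of the work, leaving the
resultant force and moment of `Ψ`, which vanish. -/
lemma energyForm_eq_inner_of_balance {Φ Ψ : F.L2} (hΦ : Φ ∈ F.formDomain)
    (hΨ : Ψ ∈ F.operatorDomain) : F.energyForm Φ Ψ = inner ℂ Φ (diffExpr Ψ) := by
  classical
  rw [mem_formDomain] at hΦ
  rw [mem_operatorDomain] at hΨ
  rw [energyForm_eq_inner_sub hΦ.1 hΨ.1, sum_org_sub_ter, Finset.sum_eq_zero, sub_zero]
  intro 𝔳 _
  by_cases hex : ∃ e₀, F.Incident e₀ 𝔳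
  · obtain ⟨e₀, he₀⟩ := hex
    have h := sum_sign_mul_work Ψ 𝔳 (fun e he => (hΦ.2 𝔳).1 e e₀ he he₀)
      (fun e he => (hΦ.2 𝔳).2 e e₀ he he₀)
    have hF := (hΨ.2 𝔳).2.2.1
    have hM := (hΨ.2 𝔳).2.2.2
    rw [ForceBalance] at hF
    rw [MomentBalance] at hM
    rw [hF, hM, dotProduct_zero, dotProduct_zero, add_zero] at h
    exact h
  · refine Finset.sum_eq_zero fun e he => ?_
    exact absurd ⟨e, (Finset.mem_filter.1 he).2⟩ hex

open scoped ComplexOrder in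
-- The test configuration `Φ` takes the resultant force and moment of `Ψ` themselves as its joint
-- displacements and rotations. The total work is then a sum of squared norms, and it is zero.
lemma balance_of_energyForm_eq_inner {Ψ : F.L2} (hΨ : ∀ p, MemH (2 * p.2.order) (Ψ p))
    (h : ∀ Φ ∈ F.formDomain, F.energyForm Φ Ψ = inner ℂ Φ (diffExpr Ψ)) (𝔳 : V) :
    ForceBalance Ψ 𝔳 ∧ MomentBalance Ψ 𝔳 := by
  classical
  let X : V → Fin 3 → ℂ := fun 𝔳 => ∑ e : E with F.Incident e 𝔳, F.sign e 𝔳 • force Ψ e 𝔳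
  let Y : V → Fin 3 → ℂ := fun 𝔳 => ∑ e : E with F.Incident e 𝔳, F.sign e 𝔳 • moment Ψ e 𝔳
  suffices hXY : X 𝔳 = 0 ∧ Y 𝔳 = 0 by
    rw [ForceBalance, MomentBalance]
    convert hXY
  obtain ⟨Φ, hΦ, hΦ'⟩ := F.exists_displacement_rotation X Y
  have hsum := h Φ hΦ
  rw [energyForm_eq_inner_sub (mem_formDomain.1 hΦ).1 hΨ, sub_eq_self, sum_org_sub_ter,
    Finset.sum_congr rfl fun 𝔳 _ => sum_sign_mul_work Ψ 𝔳 (fun e he => (hΦ' e 𝔳 he).1)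
      (fun e he => (hΦ' e 𝔳 he).2)] at hsum
  by_cases hmem : 𝔳 ∈ Finset.univ.image F.org ∪ Finset.univ.image F.ter
  · have hz := (Finset.sum_eq_zero_iff_of_nonneg fun 𝔳 _ =>
      add_nonneg (dotProduct_star_self_nonneg (X 𝔳)) (dotProduct_star_self_nonneg (Y 𝔳))).1
        hsum 𝔳 hmem
    have hz' := (add_eq_zero_iff_of_nonneg (dotProduct_star_self_nonneg (X 𝔳))
      (dotProduct_star_self_nonneg (Y 𝔳))).1 hz
    exact ⟨dotProduct_star_self_eq_zero.1 hz'.1, dotProduct_star_self_eq_zero.1 hz'.2⟩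
  -- At a vertex without beams both resultants are empty sums.
  · have hno : ∀ e, ¬ F.Incident e 𝔳 := by
      rintro e (he | he)
      · exact hmem (Finset.mem_union_left _ (Finset.mem_image.2 ⟨e, Finset.mem_univ _, he⟩))
      · exact hmem (Finset.mem_union_right _ (Finset.mem_image.2 ⟨e, Finset.mem_univ _, he⟩))
    simp [X, Y, hno]

/-! ### The operator associated with the energy form -/

/-- Interior regularity of the configurations in the domain of the associated operator. -/
lemma isWeakDeriv_of_energyForm_eq_inner {Ψ Θ : F.L2} (hΨ : Regular Ψ)
    (h : ∀ Φ ∈ F.formDomain, F.energyForm Φ Ψ = inner ℂ Φ Θ) (p : E × DOF) :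
    IsWeakDeriv (F.length p.1) (2 * p.2.order) (Ψ p)
      (((-1 : ℂ) ^ p.2.order * (F.stiffness p : ℂ)⁻¹) • Θ p) := by
  have hs : (F.stiffness p : ℂ) ≠ 0 := by exact_mod_cast (F.stiffness_pos p).ne'
  rw [two_mul]
  -- It suffices to differentiate the top derivative in the energy `p.2.order` more times; the weak
  -- equation tested with a field concentrated on `p` says precisely this.
  refine (hΨ p).isWeakDeriv.comp (isWeakDeriv_iff.2 fun φ hφ => ?_)
  have h1 := h _ (F.testField_mem_formDomain p hφ)
  rw [energyForm_testField, inner_testField] at h1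
  have sq : ((-1 : ℂ) ^ p.2.order) * (-1) ^ p.2.order = 1 := by rw [← mul_pow]; simp
  rw [inner_smul_right, ← h1, ← mul_assoc, ← mul_assoc, ← mul_assoc, sq, one_mul,
    inv_mul_cancel₀ hs, one_mul]

lemma mem_operatorDomain_iff (Ψ Θ : F.L2) :
    (Ψ ∈ F.formDomain ∧ ∀ Φ ∈ F.formDomain, F.energyForm Φ Ψ = inner ℂ Φ Θ) ↔
      Ψ ∈ F.operatorDomain ∧ Θ = diffExpr Ψ := by
  constructor
  · rintro ⟨hΨ, h⟩
    have hwd := isWeakDeriv_of_energyForm_eq_inner (mem_formDomain.1 hΨ).1 h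
    have hreg : ∀ p, MemH (2 * p.2.order) (Ψ p) := fun p => (hwd p).memH (F.length_pos _)
    have hΘ : Θ = diffExpr Ψ := by
      refine PiLp.ext fun p => ?_
      have hs : (F.stiffness p : ℂ) ≠ 0 := by exact_mod_cast (F.stiffness_pos p).ne'
      have sq : ((-1 : ℂ) ^ p.2.order) * (-1) ^ p.2.order = 1 := by rw [← mul_pow]; simp
      rw [diffExpr_apply, (hwd p).weakDeriv_eq, smul_smul, mul_mul_mul_comm, sq,
        mul_inv_cancel₀ hs, one_mul, one_smul]
    refine ⟨mem_operatorDomain.2 ⟨hreg, fun 𝔳 => ?_⟩, hΘ⟩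
    rw [hΘ] at h
    have h1 := (mem_formDomain.1 hΨ).2 𝔳
    have h2 := balance_of_energyForm_eq_inner hreg h 𝔳
    exact ⟨h1.1, h1.2, h2.1, h2.2⟩
  · rintro ⟨hΨ, rfl⟩
    have h := mem_operatorDomain.1 hΨ
    exact ⟨mem_formDomain.2 ⟨regular_of_memH_two_mul h.1, fun 𝔳 => ⟨(h.2 𝔳).1, (h.2 𝔳).2.1⟩⟩,
      fun Φ hΦ => energyForm_eq_inner_of_balance hΦ hΨ⟩

end BeamFrame

end

end BeamTheory

theorem theorem3p2 {V E : Type*} [Fintype E] (F : BeamTheory.BeamFrame V E) :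
    BeamTheory.IsClosedNonnegForm F.formDomain F.energyForm ∧
    ∃ H : F.L2 →ₗ.[ℂ] F.L2,
      Dense (H.domain : Set F.L2) ∧
      IsSelfAdjoint H ∧
      BeamTheory.IsAssociatedOperator F.formDomain F.energyForm H ∧
      (H.domain : Set F.L2) = F.operatorDomain ∧
      ∀ (Ψ : H.domain) (e : E),
        H Ψ (e, .v) = (F.a e : ℂ) • BeamTheory.weakDeriv 4 ((Ψ : F.L2) (e, .v)) ∧
        H Ψ (e, .w) = (F.b e : ℂ) • BeamTheory.weakDeriv 4 ((Ψ : F.L2) (e, .w)) ∧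
        H Ψ (e, .u) = -((F.c e : ℂ) • BeamTheory.weakDeriv 2 ((Ψ : F.L2) (e, .u))) ∧
        H Ψ (e, .η) = -((F.d e : ℂ) • BeamTheory.weakDeriv 2 ((Ψ : F.L2) (e, .η))) := by
  refine ⟨BeamTheory.isClosedNonnegForm_of_isClosed F.strain F.isClosed_strain
    F.dense_formDomain F.energyForm BeamTheory.BeamFrame.energyForm_eq_inner_strain, ?_⟩
  obtain ⟨H, hdense, hsa, hass⟩ := BeamTheory.exists_isSelfAdjoint_isAssociatedOperator F.strain
    F.isClosed_strain F.dense_formDomain F.energyForm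
    BeamTheory.BeamFrame.energyForm_eq_inner_strain
  -- The graph of `H` encodes both remaining claims: its first components are the domain, its second
  -- components the action.
  have hgraph : ∀ Ψ Θ, (Ψ, Θ) ∈ H.graph ↔
      Ψ ∈ F.operatorDomain ∧ Θ = BeamTheory.BeamFrame.diffExpr Ψ := fun Ψ Θ =>
    (hass Ψ Θ).trans (BeamTheory.BeamFrame.mem_operatorDomain_iff Ψ Θ)
  refine ⟨H, hdense, hsa, hass, Set.ext fun Ψ => ⟨fun hΨ => ?_, fun hΨ => ?_⟩, fun Ψ e => ?_⟩
  · exact ((hgraph Ψ (H ⟨Ψ, hΨ⟩)).1 (H.mem_graph ⟨Ψ, hΨ⟩)).1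
  · obtain ⟨Ψ', h, -⟩ := H.mem_graph_iff.1 ((hgraph Ψ _).2 ⟨hΨ, rfl⟩)
    rw [← show (Ψ' : F.L2) = Ψ from h]
    exact Ψ'.2
  · rw [((hgraph Ψ (H Ψ)).1 (H.mem_graph Ψ)).2]
    simp only [BeamTheory.BeamFrame.diffExpr_apply, BeamTheory.BeamFrame.stiffness,
      BeamTheory.DOF.order, Nat.reduceMul]
    simp
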